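/- Let $d\ge 1$ and let $X=\{1,\dots,d\}^{\mathbb N}$ carry the metric $d_\theta(x,y)=\theta^{n}$, where $0<\theta<1$ and $n\ge1$ is the first index with $x_n\ne y_n$ (and $d_\theta(x,x)=0$). For $x\in X$ write $j*x=(j,x_1,x_2,\dots)$. Let $\sim$ be an equivalence relation on $X$ with finite classes $[x]$, and suppose that it has a continuous representation $\psi$: for each $1\le j\le d$ there are a number $k_j$ and continuous maps $x\mapsto\psi_i(j*x)$, $1\le i\le k_j$, from $X$ to $X$, such that for every $x$ the points $\psi_1(j*x),\dots,\psi_{k_j}(j*x)$ are pairwise distinct and $[j*x]=\{\psi_1(j*x),\dots,\psi_{k_j}(j*x)\}$. Assume that the representation is Lipschitz with $\max_{i,j}\mathrm{Lip}(\psi_i(j*\cdot))<1$. Let $G=\{(x,y)\in X^2: x\sim y\}$, let $\nu^x$ be the counting measure on $[x]$, let $V:X\to\mathbb R$ be $\alpha$-Hölder for some $\alpha>0$, let $c(x,y)=V(y)-V(x)$ for $(x,y)\in G$, and let $\beta\in\mathbb R$. Consider the iterated function system with weights $$R=\bigl(X,\ \tau_{ij},\ q_{ij}\bigr),\qquad \tau_{ij}(x)=\psi_i(j*x),\quad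 q_{ij}(x)=e^{-\beta V(\psi_i(j*x))},$$ and the operator $B_R(f)(x)=\sum_{i,j}q_{ij}(x)f(\tau_{ij}(x))$. Then: 1. $R$ is contractive: there is $L<1$ with $d_\theta(\tau_{ij}(x),\tau_{ij}(z))\le L\,d_\theta(x,z)$ for all $i,j,x,z$. 2. The weights are Dini continuous: $\int_0^1\sup_{d_\theta(x,z)\le t}\frac{|\ln q_{ij}(x)-\ln q_{ij}(z)|}{t}\,dt<\infty$ for all $i,j$. 3. There is a unique non-empty compact set $K\subset X$ (the attractor) with $\bigcup_{i,j}\tau_{ij}(K)=K$. The spectral radius $\rho$ of $B_R$ acting on $C(K)$ is positive, and there are a unique $h\in C(K)$, $h>0$, and a unique Borel probability $\mu$ on $K$ with $B_R(h)=\rho h$, $B_R^*(\mu)=\rho\mu$ and $\int h\,d\mu=1$. 4. This eigenmeasure $\mu$, regarded as a probability $M$ on $X$, is $(c,\beta)$-quasi-invariant: for every Borel function $g:G\to\mathbb R$ with $\int\int|g(s,x)|\,d\nu^x(s)\,dM(x)<\infty$, the right-hand side below converges absolutely and $$\int\int g(s,x)\,d\nu^x(s)\,dM(x)=\int\int g(x,s)\,e^{-\beta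 c(x,s)}\,d\nu^x(s)\,dM(x).$$ -/

import Mathlib

open MeasureTheory
open scoped ENNReal

/-! ### The symbolic space -/

/-- The symbolic space of one-sided sequences over an alphabet with `d` symbols
(product topology, Borel sigma-algebra). -/
abbrev SymbolicSpace (d : ℕ) : Type := ℕ → Fin d

/-- The concatenation `j * x = (j, x₁, x₂, …)`. -/
def concat {d : ℕ} (j : Fin d) (x : SymbolicSpace d) : SymbolicSpace d
  | 0 => j
  | n + 1 => x n

/-- The usual metric: `θ ^ n` where `n ≥ 1` is the first (1-based) position at which the two
sequences differ. -/
noncomputable def symDist {d : ℕ} (θ : ℝ) (x y : SymbolicSpace d) : ℝ :=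
  open Classical in if x = y then 0 else θ ^ (PiNat.firstDiff x y + 1)

/-! ### Representations of an equivalence relation, cocycles, quasi-invariance -/

/-- `ψ j i x` stands for `ψ_i(j * x)`: for all `j` and `x`, the points
`ψ_1(j * x), …, ψ_k(j * x)` list the equivalence class `[j * x]` without repetition. The number `k`
of elements may depend on `j`. -/
def IsRepresentation {d : ℕ} (r : Setoid (SymbolicSpace d)) {k : Fin d → ℕ}
    (ψ : (j : Fin d) → Fin (k j) → C(SymbolicSpace d, SymbolicSpace d)) : Prop :=
  ∀ (j : Fin d) (x : SymbolicSpace d),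
    Function.Injective (fun i => ψ j i x) ∧
      Set.range (fun i => ψ j i x) = {s | r s (concat j x)}

/-- `c(x, y) = V(y) - V(x)` on the groupoid `{(x, y) | x ∼ y}`. Values of `c` off the groupoid
play no role. -/
def IsSeparableCocycle {d : ℕ} (r : Setoid (SymbolicSpace d))
    (c : SymbolicSpace d → SymbolicSpace d → ℝ) (V : SymbolicSpace d → ℝ) : Prop :=
  ∀ x y, r x y → c x y = V y - V x

/-- The transverse function: `ν^x` is the counting measure on the class `[x]`. -/
noncomputable def transverse {d : ℕ} (r : Setoid (SymbolicSpace d)) (x : SymbolicSpace d) :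
    Measure (SymbolicSpace d) :=
  Measure.count.restrict {s | r s x}

/-- The `(c, β)`-quasi-invariant condition. The test function `h` lives on the groupoid
`G = {(x, y) | x ∼ y}` (it is extended to `X × X` in an arbitrary way, which does not affect any of
the integrals); it is Borel on `G`, and integrable in the sense that the left-hand double integral
converges absolutely. The right-hand one is required to converge absolutely and to be equal to
it. -/
def IsQuasiInvariant {d : ℕ} (r : Setoid (SymbolicSpace d))
    (c : SymbolicSpace d → SymbolicSpace d → ℝ) (β : ℝ)
    (M : ProbabilityMeasure (SymbolicSpace d)) : Prop :=
  ∀ h : SymbolicSpace d → SymbolicSpace d → ℝ,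
    Measurable (fun p : {p : SymbolicSpace d × SymbolicSpace d // r p.1 p.2} =>
      h p.1.1 p.1.2) →
    (∫⁻ x, ∫⁻ s, ‖h s x‖ₑ ∂(transverse r x) ∂(M : Measure (SymbolicSpace d))) < ∞ →
    (∫⁻ x, ∫⁻ s, ‖h x s * Real.exp (-β * c x s)‖ₑ ∂(transverse r x)
        ∂(M : Measure (SymbolicSpace d))) < ∞ ∧
      ∫ x, ∫ s, h s x ∂(transverse r x) ∂(M : Measure (SymbolicSpace d)) =
        ∫ x, ∫ s, h x s * Real.exp (-β * c x s) ∂(transverse r x)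
          ∂(M : Measure (SymbolicSpace d))

/-! ### Iterated function systems with weights -/

/-- An iterated function system with positive weights `(Y, τ_i, q_i)`. -/
structure WeightedIFS (Y ι : Type*) [TopologicalSpace Y] where
  map : ι → C(Y, Y)
  weight : ι → C(Y, ℝ)
  weight_pos : ∀ i y, 0 < weight i y

namespace WeightedIFS

variable {Y ι : Type*} [TopologicalSpace Y]

/-- The maps are uniformly contracting for the distance function `D`. -/
def IsContractive (R : WeightedIFS Y ι) (D : Y → Y → ℝ) : Prop :=
  ∃ L : ℝ, 0 ≤ L ∧ L < 1 ∧ ∀ i y z, D (R.map i y) (R.map i z) ≤ L * D y z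

/-- Dini continuity of the weights:
`∫_0^1 sup_{D(y,z) ≤ t} |ln q_i(y) - ln q_i(z)| / t dt < ∞` for each `i`. -/
def HasDiniWeights (R : WeightedIFS Y ι) (D : Y → Y → ℝ) : Prop :=
  ∀ i, (∫⁻ t in Set.Ioc (0 : ℝ) 1, ⨆ (y : Y) (z : Y) (_ : D y z ≤ t),
    ENNReal.ofReal (|Real.log (R.weight i y) - Real.log (R.weight i z)| / t)) < ∞

/-- The non-empty compact set `K` satisfies `⋃ τ_i(K) = K`. -/
def IsAttractor (R : WeightedIFS Y ι) (K : TopologicalSpace.NonemptyCompacts Y) : Prop :=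
  ⋃ i, R.map i '' (K : Set Y) = (K : Set Y)

theorem IsAttractor.map_mem {R : WeightedIFS Y ι} {K : TopologicalSpace.NonemptyCompacts Y}
    (hK : R.IsAttractor K) (i : ι) (y : K) : R.map i y ∈ K := by
  have h : R.map i y ∈ ⋃ i, R.map i '' (K : Set Y) :=
    Set.mem_iUnion.2 ⟨i, Set.mem_image_of_mem _ y.2⟩
  rw [show _ = _ from hK] at h
  exact h

/-- The restriction of the system to an attractor. -/
def restrict (R : WeightedIFS Y ι) (K : TopologicalSpace.NonemptyCompacts Y)
    (hK : R.IsAttractor K) : WeightedIFS K ι where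
  map i := ⟨fun y => ⟨R.map i y, hK.map_mem i y⟩, by fun_prop⟩
  weight i := ⟨fun y => R.weight i y, by fun_prop⟩
  weight_pos i y := R.weight_pos i y

/-- The operator `B_R(f)(y) = ∑ q_i(y) f(τ_i y)` on continuous functions with values in `𝕜`. -/
noncomputable def transfer [CompactSpace Y] [Fintype ι] (R : WeightedIFS Y ι) (𝕜 : Type*) [RCLike 𝕜] :
    C(Y, 𝕜) →L[𝕜] C(Y, 𝕜) where
  toFun f := ∑ i, (⟨fun y => (R.weight i y : 𝕜), by fun_prop⟩ : C(Y, 𝕜)) * f.comp (R.map i)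
  map_add' f g := by
    simp only [ContinuousMap.add_comp, mul_add, Finset.sum_add_distrib]
  map_smul' a f := by
    simp only [ContinuousMap.smul_comp, mul_smul_comm, Finset.smul_sum, RingHom.id_apply]
  cont := continuous_finsetSum _ fun i _ =>
    continuous_const.mul (ContinuousMap.continuous_precomp (R.map i))

theorem transfer_apply [CompactSpace Y] [Fintype ι] (R : WeightedIFS Y ι) (𝕜 : Type*) [RCLike 𝕜]
    (f : C(Y, 𝕜)) (y : Y) :
    R.transfer 𝕜 f y = ∑ i, (R.weight i y : 𝕜) * f (R.map i y) := by
  simp [transfer]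

/-- The spectral radius `ρ` of `B_R`, computed on complex-valued continuous functions. -/
noncomputable def rho [CompactSpace Y] [Fintype ι] (R : WeightedIFS Y ι) : ℝ :=
  (spectralRadius ℂ (R.transfer ℂ)).toReal

/-- `h > 0`, `B_R(h) = ρ h`, `B_R^*(μ) = ρ μ` and `∫ h dμ = 1`. -/
structure IsPerronPair [CompactSpace Y] [Fintype ι] [MeasurableSpace Y] (R : WeightedIFS Y ι)
    (h : C(Y, ℝ)) (μ : ProbabilityMeasure Y) : Prop where
  pos : ∀ y, 0 < h y
  eigenfunction : R.transfer ℝ h = R.rho • h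
  eigenmeasure : ∀ f : C(Y, ℝ),
    ∫ y, R.transfer ℝ f y ∂(μ : Measure Y) = R.rho * ∫ y, f y ∂(μ : Measure Y)
  normalized : ∫ y, h y ∂(μ : Measure Y) = 1

end WeightedIFS

/-- The weighted system `(X, ψ_i(j * ·), e^{-β V(ψ_i(j * ·))})`, indexed by the pairs `(j, i)`. -/
noncomputable def haarIFS {d : ℕ} {k : Fin d → ℕ}
    (ψ : (j : Fin d) → Fin (k j) → C(SymbolicSpace d, SymbolicSpace d))
    (V : C(SymbolicSpace d, ℝ)) (β : ℝ) :
    WeightedIFS (SymbolicSpace d) ((j : Fin d) × Fin (k j)) where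
  map p := ψ p.1 p.2
  weight p := ⟨fun x => Real.exp (-β * V (ψ p.1 p.2 x)), by fun_prop⟩
  weight_pos _ _ := Real.exp_pos _

/-! Since `x ∈ [x]` and `x` is its first letter followed by its tail, the images of the maps `ψ_i(j
* ·)` cover `X`. A contraction lengthens common prefixes, so any attractor contains points agreeing
with a given sequence to any depth. Being closed, it is all of `X`.

The spectral part is Birkhoff's cone method. With the gauge `D = d_θ ^ α`, the log of each weight is
`D`-Lipschitz, so for large `A` the operator sends the cone `f x ≤ exp (A * D x z) * f z` into the
same cone with a smaller constant `A'`. The small cone has bounded diameter in the large one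
(`exists_sub_smul_mem_distortionCone`), so brackets `m f ≤ g ≤ M f` in the cone order shrink
geometrically under iteration (`exists_bracket_transfer`, `exists_abs_sub_le`). This gives a
positive eigenfunction `h` with eigenvalue `l`, and then `l⁻ⁿ Bⁿ f → c(f) h`, first for Lipschitz
`f` and by density for all `f`. The functional `c`, normalized, is the eigenmeasure by Riesz, and
the same limit forces uniqueness. Positivity of `h` bounds `‖Bⁿ‖` by a multiple of `lⁿ`, so `l` is
the spectral radius.

For quasi-invariance, `ρ ∫ F dM = ∫ ∑ q_{ij} F(τ_{ij}) dM` holds for Borel `F`. Taking `F(y) = ∑_{s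
∼ y} g(s, y)`, the part of the sum belonging to `j` runs over pairs `(s, y)` in `[j * x]` of `exp
(-β V y) g(s, y)`. Exchanging `s` and `y` turns it into the corresponding sum for the right-hand
side, because `exp (-β V s) = exp (-β V y) exp (-β (V s - V y))`. -/

open Filter Topology

/-! ### The cone of functions with bounded distortion -/

namespace WeightedIFS

section Cone

variable {Y ι : Type*} [TopologicalSpace Y]

/-- Nonnegative continuous functions whose logarithm is `A`-Lipschitz for `D`. -/
def distortionCone (D : Y → Y → ℝ) (A : ℝ) : Set C(Y, ℝ) :=
  {f | (∀ y, 0 ≤ f y) ∧ ∀ x z, f x ≤ Real.exp (A * D x z) * f z}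

/-- `D` is a bounded symmetric gauge which is contracted by the maps of the system and controls the
distortion of the weights. -/
structure HasBoundedDistortion (R : WeightedIFS Y ι) (D : Y → Y → ℝ) (κ C : ℝ) : Prop where
  nonneg : ∀ x z, 0 ≤ D x z
  le_one : ∀ x z, D x z ≤ 1
  symm : ∀ x z, D x z = D z x
  contract : ∀ i x z, D (R.map i x) (R.map i z) ≤ κ * D x z
  weight_le : ∀ i x z, R.weight i x ≤ Real.exp (C * D x z) * R.weight i z

variable {D : Y → Y → ℝ} {A : ℝ}

theorem distortionCone_smul {f : C(Y, ℝ)} (hf : f ∈ distortionCone D A) {t : ℝ} (ht : 0 ≤ t) :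
    t • f ∈ distortionCone D A := by
  refine ⟨fun y => mul_nonneg ht (hf.1 y), fun x z => ?_⟩
  have := mul_le_mul_of_nonneg_left (hf.2 x z) ht
  simp only [ContinuousMap.coe_smul, Pi.smul_apply, smul_eq_mul]
  linarith

theorem isClosed_distortionCone [CompactSpace Y] : IsClosed (distortionCone D A) := by
  have h : distortionCone D A = (⋂ y, {f : C(Y, ℝ) | 0 ≤ f y}) ∩
      ⋂ x, ⋂ z, {f : C(Y, ℝ) | f x ≤ Real.exp (A * D x z) * f z} := by
    ext f
    simp [distortionCone]
  rw [h]
  refine (isClosed_iInter fun y => isClosed_le continuous_const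
    (continuous_eval_const y)).inter
    (isClosed_iInter fun x => isClosed_iInter fun z => ?_)
  exact isClosed_le (continuous_eval_const x)
    (continuous_const.mul (continuous_eval_const z))

/-- Subtracting a small multiple of a function of a smaller cone stays in the larger cone. -/
theorem exists_sub_smul_mem_distortionCone (h0 : ∀ x z, 0 ≤ D x z) (h1 : ∀ x z, D x z ≤ 1)
    (hs : ∀ x z, D x z = D z x) {A' : ℝ} (hA' : 0 ≤ A') (hA : A' < A) :
    ∃ δ : ℝ, 0 < δ ∧ δ < 1 ∧ ∀ u ∈ distortionCone D A', ∀ v ∈ distortionCone D A',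
      ∀ (x₀ : Y) (a : ℝ), 0 ≤ a → a * v x₀ ≤ u x₀ → u - (δ * a) • v ∈ distortionCone D A := by
  -- `η` is the ratio of the two linear-in-`t` bounds compared in `hkey`, where `t = D x z`: it
  -- makes `u - w` keep the constant `A` whenever `w ≤ η u` and `w` is a multiple of `v`.
  set η : ℝ := (A - A') / ((A + A') * Real.exp A) with hη
  have hApos : 0 < A := hA'.trans_lt hA
  have hden : 0 < (A + A') * Real.exp A := by positivity
  have hη0 : 0 < η := div_pos (by linarith) hden
  have hη1 : η < 1 := by
    rw [hη, div_lt_one hden]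
    nlinarith [Real.add_one_le_exp A]
  have hηmul : η * ((A + A') * Real.exp A) = A - A' := div_mul_cancel₀ _ hden.ne'
  -- Comparing `u` and `v` at `x₀` controls them everywhere at the cost of one factor `exp A'` for
  -- each, since `D ≤ 1`.
  refine ⟨η * Real.exp (-(2 * A')), by positivity, ?_, ?_⟩
  · have : Real.exp (-(2 * A')) ≤ 1 := Real.exp_le_one_iff.2 (by linarith)
    nlinarith [Real.exp_pos (-(2 * A'))]
  intro u hu v hv x₀ a ha hle
  have hexp : ∀ x z, Real.exp (A' * D x z) ≤ Real.exp A' := fun x z =>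
    Real.exp_le_exp.2 (by nlinarith [h1 x z, h0 x z])
  have hw : ∀ z, η * Real.exp (-(2 * A')) * a * v z ≤ η * u z := by
    intro z
    have e1 : v z ≤ Real.exp A' * v x₀ :=
      (hv.2 z x₀).trans (mul_le_mul_of_nonneg_right (hexp _ _) (hv.1 _))
    have e2 : u x₀ ≤ Real.exp A' * u z :=
      (hu.2 x₀ z).trans (mul_le_mul_of_nonneg_right (hexp _ _) (hu.1 _))
    have e3 : a * v z ≤ Real.exp (2 * A') * u z := by
      calc a * v z ≤ a * (Real.exp A' * v x₀) := mul_le_mul_of_nonneg_left e1 ha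
        _ = Real.exp A' * (a * v x₀) := by ring
        _ ≤ Real.exp A' * (Real.exp A' * u z) :=
          mul_le_mul_of_nonneg_left (hle.trans e2) (Real.exp_pos _).le
        _ = Real.exp (2 * A') * u z := by rw [two_mul, Real.exp_add]; ring
    calc η * Real.exp (-(2 * A')) * a * v z = η * Real.exp (-(2 * A')) * (a * v z) := by ring
      _ ≤ η * Real.exp (-(2 * A')) * (Real.exp (2 * A') * u z) :=
        mul_le_mul_of_nonneg_left e3 (by positivity)
      _ = η * (Real.exp (-(2 * A')) * Real.exp (2 * A')) * u z := by ring
      _ = η * u z := by rw [← Real.exp_add]; simp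
  have hw0 : ∀ z, 0 ≤ η * Real.exp (-(2 * A')) * a * v z := fun z =>
    mul_nonneg (by positivity) (hv.1 z)
  refine ⟨fun y => ?_, fun x z => ?_⟩
  · have := hw y
    have := hu.1 y
    simp only [ContinuousMap.sub_apply, ContinuousMap.smul_apply, smul_eq_mul]
    nlinarith
  simp only [ContinuousMap.sub_apply, ContinuousMap.smul_apply, smul_eq_mul]
  set t := D x z with ht
  have ht0 : 0 ≤ t := h0 x z
  have ht1 : t ≤ 1 := h1 x z
  have hwx : Real.exp (-(A' * t)) * (η * Real.exp (-(2 * A')) * a * v z) ≤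
      η * Real.exp (-(2 * A')) * a * v x := by
    have e := hv.2 z x
    rw [hs z x, ← ht] at e
    have e' : Real.exp (-(A' * t)) * v z ≤ v x := by
      calc Real.exp (-(A' * t)) * v z ≤ Real.exp (-(A' * t)) * (Real.exp (A' * t) * v x) :=
            mul_le_mul_of_nonneg_left e (Real.exp_pos _).le
        _ = v x := by rw [← mul_assoc, ← Real.exp_add]; simp
    calc _ = η * Real.exp (-(2 * A')) * a * (Real.exp (-(A' * t)) * v z) := by ring
      _ ≤ _ := mul_le_mul_of_nonneg_left e' (by positivity)
  have hux := hu.2 x z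
  rw [← ht] at hux
  have hkey : η * (Real.exp (A * t) - Real.exp (-(A' * t))) ≤
      Real.exp (A * t) - Real.exp (A' * t) := by
    have k1 : Real.exp (A * t) - Real.exp (-(A' * t)) ≤ (A + A') * t * Real.exp A := by
      have e : Real.exp (-(A' * t)) = Real.exp (A * t) * Real.exp (-((A + A') * t)) := by
        rw [← Real.exp_add]; ring_nf
      have e2 := Real.add_one_le_exp (-((A + A') * t))
      have e3 : Real.exp (A * t) ≤ Real.exp A := Real.exp_le_exp.2 (by nlinarith)
      have e4 : 0 ≤ (A + A') * t := by positivity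
      rw [e]
      nlinarith [Real.exp_pos (A * t)]
    have k2 : (A - A') * t ≤ Real.exp (A * t) - Real.exp (A' * t) := by
      have e : Real.exp (A * t) = Real.exp (A' * t) * Real.exp ((A - A') * t) := by
        rw [← Real.exp_add]; ring_nf
      have e2 := Real.add_one_le_exp ((A - A') * t)
      have e3 : 1 ≤ Real.exp (A' * t) := Real.one_le_exp (by positivity)
      have e4 : 0 ≤ (A - A') * t := mul_nonneg (by linarith) ht0
      rw [e]
      nlinarith
    calc _ ≤ η * ((A + A') * t * Real.exp A) := mul_le_mul_of_nonneg_left k1 hη0.le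
      _ = (A - A') * t := by rw [← hηmul]; ring
      _ ≤ _ := k2
  set w := η * Real.exp (-(2 * A')) * a * v z with hwdef
  have hlt : Real.exp (-(A' * t)) ≤ Real.exp (A * t) := Real.exp_le_exp.2 (by nlinarith)
  have hfin : (Real.exp (A * t) - Real.exp (-(A' * t))) * w ≤
      (Real.exp (A * t) - Real.exp (A' * t)) * u z := by
    calc _ ≤ (Real.exp (A * t) - Real.exp (-(A' * t))) * (η * u z) :=
          mul_le_mul_of_nonneg_left (hw z) (by linarith)
      _ = η * (Real.exp (A * t) - Real.exp (-(A' * t))) * u z := by ring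
      _ ≤ _ := mul_le_mul_of_nonneg_right hkey (hu.1 z)
  linarith

variable [CompactSpace Y] [Fintype ι] {R : WeightedIFS Y ι} {κ C : ℝ}

/-- Contraction of the maps multiplies the old distortion by `κ`, and the weights add `C`. The bound
holds summand by summand. -/
theorem HasBoundedDistortion.transfer_mem (hR : R.HasBoundedDistortion D κ C) (hA : 0 ≤ A)
    {f : C(Y, ℝ)} (hf : f ∈ distortionCone D A) :
    R.transfer ℝ f ∈ distortionCone D (κ * A + C) := by
  refine ⟨fun y => ?_, fun x z => ?_⟩
  · rw [transfer_apply]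
    exact Finset.sum_nonneg fun i _ => mul_nonneg (R.weight_pos i y).le (hf.1 _)
  rw [transfer_apply, transfer_apply, Finset.mul_sum]
  refine Finset.sum_le_sum fun i _ => ?_
  simp only [RCLike.ofReal_real_eq_id, id_eq]
  have h1 : f (R.map i x) ≤ Real.exp (κ * A * D x z) * f (R.map i z) := by
    refine (hf.2 _ _).trans (mul_le_mul_of_nonneg_right (Real.exp_le_exp.2 ?_) (hf.1 _))
    nlinarith [hR.contract i x z]
  calc R.weight i x * f (R.map i x)
      ≤ (Real.exp (C * D x z) * R.weight i z) * (Real.exp (κ * A * D x z) * f (R.map i z)) :=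
        mul_le_mul (hR.weight_le i x z) h1 (hf.1 _)
          (mul_nonneg (Real.exp_pos _).le (R.weight_pos i z).le)
    _ = _ := by rw [add_mul, Real.exp_add]; ring

theorem transfer_mono {f g : C(Y, ℝ)} (h : ∀ y, f y ≤ g y) (y : Y) :
    R.transfer ℝ f y ≤ R.transfer ℝ g y := by
  rw [transfer_apply, transfer_apply]
  exact Finset.sum_le_sum fun i _ => mul_le_mul_of_nonneg_left (h _) (R.weight_pos i y).le

theorem transfer_pow_mono {f g : C(Y, ℝ)} (h : ∀ y, f y ≤ g y) (n : ℕ) (y : Y) :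
    (R.transfer ℝ ^ n) f y ≤ (R.transfer ℝ ^ n) g y := by
  induction n generalizing y with
  | zero => exact h y
  | succ n ih =>
    rw [pow_succ']
    exact transfer_mono ih y

theorem transfer_pos [Nonempty ι] {f : C(Y, ℝ)} (h : ∀ y, 0 < f y) (y : Y) :
    0 < R.transfer ℝ f y := by
  rw [transfer_apply]
  exact Finset.sum_pos (fun i _ => mul_pos (R.weight_pos i y) (h _)) Finset.univ_nonempty

theorem transfer_pow_pos [Nonempty ι] {f : C(Y, ℝ)} (h : ∀ y, 0 < f y) (n : ℕ) (y : Y) :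
    0 < (R.transfer ℝ ^ n) f y := by
  induction n generalizing y with
  | zero => exact h y
  | succ n ih =>
    rw [pow_succ']
    exact transfer_pos ih y

end Cone

end WeightedIFS

/-! ### Birkhoff contraction and the positive eigenfunction -/

namespace WeightedIFS

section Perron

variable {Y ι : Type*} [TopologicalSpace Y] [CompactSpace Y] [Fintype ι]

/-- A pair of nested cones such that the transfer operator maps the larger one into the smaller one,
the smaller one having finite diameter (measured by `δ`) in the larger one. -/
structure IsContractedCone (R : WeightedIFS Y ι) (D : Y → Y → ℝ) (A A' δ : ℝ) : Prop where
  gauge_nonneg : ∀ x z, 0 ≤ D x z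
  pos : 0 < A'
  δ_pos : 0 < δ
  δ_lt_one : δ < 1
  map_mem : ∀ f ∈ distortionCone D A, R.transfer ℝ f ∈ distortionCone D A'
  sub_mem : ∀ u ∈ distortionCone D A', ∀ v ∈ distortionCone D A',
      ∀ (x₀ : Y) (a : ℝ), 0 ≤ a → a * v x₀ ≤ u x₀ → u - (δ * a) • v ∈ distortionCone D A

variable {R : WeightedIFS Y ι} {D : Y → Y → ℝ}

theorem HasBoundedDistortion.exists_isContractedCone {κ C : ℝ} (hR : R.HasBoundedDistortion D κ C)
    (hκ0 : 0 ≤ κ) (hκ1 : κ < 1) (hC : 0 < C) : ∃ A A' δ, R.IsContractedCone D A A' δ := by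
  have h1 : 0 < 1 - κ := by linarith
  -- With `A = (C + 1) / (1 - κ)` one has `κ * A + C = A - 1`, so the image cone is strictly
  -- smaller.
  have hA : 0 < (C + 1) / (1 - κ) := by positivity
  have hlt : κ * ((C + 1) / (1 - κ)) + C < (C + 1) / (1 - κ) := by
    have : (1 - κ) * ((C + 1) / (1 - κ)) = C + 1 := mul_div_cancel₀ _ h1.ne'
    linarith
  have hA' : 0 < κ * ((C + 1) / (1 - κ)) + C := by positivity
  obtain ⟨δ, hδ0, hδ1, h⟩ :=
    exists_sub_smul_mem_distortionCone hR.nonneg hR.le_one hR.symm hA'.le hlt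
  exact ⟨_, _, δ, hR.nonneg, hA', hδ0, hδ1, fun f hf => hR.transfer_mem hA.le hf, h⟩

namespace IsContractedCone

variable {A A' δ : ℝ}

/-- The inclusion of the small cone in the large one is the case `a = 0` of `sub_mem`. -/
theorem mem_of_mem [Nonempty Y] (H : R.IsContractedCone D A A' δ) {u : C(Y, ℝ)}
    (hu : u ∈ distortionCone D A') : u ∈ distortionCone D A := by
  inhabit Y
  simpa using H.sub_mem u hu u hu default 0 le_rfl (by simpa using hu.1 default)

theorem one_mem (H : R.IsContractedCone D A A' δ) : (1 : C(Y, ℝ)) ∈ distortionCone D A' := by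
  refine ⟨fun y => zero_le_one, fun x z => ?_⟩
  simpa using mul_nonneg H.pos.le (H.gauge_nonneg x z)

/-- Two positive functions of the smaller cone are comparable for the order of the larger one. -/
theorem exists_bracket [Nonempty Y] (H : R.IsContractedCone D A A' δ) {u v : C(Y, ℝ)}
    (hu : u ∈ distortionCone D A') (hv : v ∈ distortionCone D A')
    (hu0 : ∀ y, 0 < u y) (hv0 : ∀ y, 0 < v y) :
    ∃ m M : ℝ, 0 < m ∧ u - m • v ∈ distortionCone D A ∧ M • v - u ∈ distortionCone D A := by
  inhabit Y
  set x₀ : Y := default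
  have hδ := H.δ_pos
  have hux := hu0 x₀
  have hvx := hv0 x₀
  refine ⟨δ * (u x₀ / v x₀), (δ * (v x₀ / u x₀))⁻¹, by positivity,
    H.sub_mem u hu v hv x₀ _ (by positivity) (by rw [div_mul_cancel₀ _ hvx.ne']), ?_⟩
  -- The upper bound is the lower bound with the roles of `u` and `v` exchanged, rescaled.
  have h := H.sub_mem v hv u hu x₀ (v x₀ / u x₀) (by positivity)
    (by rw [div_mul_cancel₀ _ hux.ne'])
  have hpos : 0 < δ * (v x₀ / u x₀) := by positivity
  have h2 := distortionCone_smul h (inv_nonneg.2 hpos.le)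
  rwa [smul_sub, smul_smul, inv_mul_cancel₀ hpos.ne', one_smul] at h2

variable [Nonempty Y] [Nonempty ι]

/-- One step of Birkhoff's contraction. The images of `g - m f` and `M f - g` lie in the small cone
and add up to `(M - m) B f`. Each dominates `δ` times its ratio to `B f` at `x₀`, and these ratios
sum to `M - m`, so the bracket loses the proportion `δ` of its width. -/
theorem exists_bracket_transfer (H : R.IsContractedCone D A A' δ) {f g : C(Y, ℝ)}
    (hf : f ∈ distortionCone D A) (hf0 : ∀ y, 0 < f y) {m M : ℝ}
    (hm : g - m • f ∈ distortionCone D A) (hM : M • f - g ∈ distortionCone D A) :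
    ∃ m' M' : ℝ, m ≤ m' ∧ M' ≤ M ∧ M' - m' = (1 - δ) * (M - m) ∧
      R.transfer ℝ g - m' • R.transfer ℝ f ∈ distortionCone D A ∧
      M' • R.transfer ℝ f - R.transfer ℝ g ∈ distortionCone D A := by
  inhabit Y
  set x₀ : Y := default
  have hv := H.map_mem f hf
  have hu₁ := H.map_mem _ hm
  have hu₂ := H.map_mem _ hM
  have hv0 : 0 < R.transfer ℝ f x₀ := transfer_pos hf0 x₀
  rw [map_sub, map_smul] at hu₁ hu₂
  set F := R.transfer ℝ f
  set G := R.transfer ℝ g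
  have ha : 0 ≤ (G - m • F) x₀ / F x₀ := div_nonneg (hu₁.1 x₀) hv0.le
  have hb : 0 ≤ (M • F - G) x₀ / F x₀ := div_nonneg (hu₂.1 x₀) hv0.le
  have hab : (G - m • F) x₀ / F x₀ + (M • F - G) x₀ / F x₀ = M - m := by
    simp only [ContinuousMap.sub_apply, ContinuousMap.smul_apply, smul_eq_mul]
    field_simp
    ring
  have k₁ := H.sub_mem _ hu₁ F hv x₀ _ ha (by rw [div_mul_cancel₀ _ hv0.ne'])
  have k₂ := H.sub_mem _ hu₂ F hv x₀ _ hb (by rw [div_mul_cancel₀ _ hv0.ne'])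
  set a := (G - m • F) x₀ / F x₀
  set b := (M • F - G) x₀ / F x₀
  have hδ := H.δ_pos
  refine ⟨m + δ * a, M - δ * b, by nlinarith, by nlinarith, ?_, ?_, ?_⟩
  · linear_combination (-δ) * hab
  · rwa [sub_sub, ← add_smul] at k₁
  · rwa [sub_right_comm, ← sub_smul] at k₂

/-- The iterates of two comparable functions become proportional exponentially fast. -/
theorem exists_abs_sub_le (H : R.IsContractedCone D A A' δ) {f g : C(Y, ℝ)}
    (hf : f ∈ distortionCone D A) (hf0 : ∀ y, 0 < f y) {m M : ℝ}
    (hm : g - m • f ∈ distortionCone D A) (hM : M • f - g ∈ distortionCone D A) :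
    ∃ c : ℝ, m ≤ c ∧ c ≤ M ∧ ∀ n y, |(R.transfer ℝ ^ n) g y - c * (R.transfer ℝ ^ n) f y| ≤
      (M - m) * (1 - δ) ^ n * (R.transfer ℝ ^ n) f y := by
  inhabit Y
  set B := R.transfer ℝ with hB
  let P : ℕ → ℝ × ℝ → Prop := fun n p =>
    (B ^ n) g - p.1 • (B ^ n) f ∈ distortionCone D A ∧
      p.2 • (B ^ n) f - (B ^ n) g ∈ distortionCone D A
  have hfn : ∀ n, (B ^ n) f ∈ distortionCone D A := by
    intro n
    induction n with
    | zero => exact hf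
    | succ n ih =>
      rw [pow_succ']
      exact H.mem_of_mem (H.map_mem _ ih)
  have hfn0 : ∀ n y, 0 < (B ^ n) f y := fun n y => transfer_pow_pos hf0 n y
  have hstep : ∀ n (p : {p // P n p}), ∃ q : {q // P (n + 1) q}, p.1.1 ≤ q.1.1 ∧ q.1.2 ≤ p.1.2 ∧
      q.1.2 - q.1.1 = (1 - δ) * (p.1.2 - p.1.1) := by
    rintro n ⟨p, hp₁, hp₂⟩
    obtain ⟨m', M', h₁, h₂, h₃, h₄, h₅⟩ := H.exists_bracket_transfer (hfn n) (hfn0 n) hp₁ hp₂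
    refine ⟨⟨(m', M'), ?_⟩, h₁, h₂, h₃⟩
    simp only [P, pow_succ']
    exact ⟨h₄, h₅⟩
  choose next hnext using hstep
  let s : ∀ n, {p // P n p} := fun n => Nat.rec ⟨(m, M), hm, hM⟩ (fun n p => next n p) n
  have hs : ∀ n, s (n + 1) = next n (s n) := fun n => rfl
  have hmono : Monotone fun n => (s n).1.1 := monotone_nat_of_le_succ fun n => by
    rw [hs]; exact (hnext n (s n)).1
  have hanti : Antitone fun n => (s n).1.2 := antitone_nat_of_succ_le fun n => by
    rw [hs]; exact (hnext n (s n)).2.1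
  have hdiff : ∀ n, (s n).1.2 - (s n).1.1 = (M - m) * (1 - δ) ^ n := by
    intro n
    induction n with
    | zero => simp [s]
    | succ n ih =>
      rw [hs, (hnext n (s n)).2.2, ih, pow_succ]
      ring
  have hle : ∀ n, (s n).1.1 ≤ (s n).1.2 := by
    intro n
    have h₁ := (s n).2.1.1 default
    have h₂ := (s n).2.2.1 default
    have h₃ := hfn0 n default
    simp only [ContinuousMap.sub_apply, ContinuousMap.smul_apply, smul_eq_mul] at h₁ h₂
    exact le_of_mul_le_mul_right (by linarith) h₃
  -- The brackets are nested intervals; `c` is a point common to all of them.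
  have hc := hmono.ciSup_mem_iInter_Icc_of_antitone hanti hle
  rw [Set.mem_iInter] at hc
  set c := ⨆ n, (s n).1.1
  refine ⟨c, (hc 0).1, (hc 0).2, fun n y => ?_⟩
  have h₁ := (s n).2.1.1 y
  have h₂ := (s n).2.2.1 y
  have h₃ := hfn0 n y
  simp only [ContinuousMap.sub_apply, ContinuousMap.smul_apply, smul_eq_mul] at h₁ h₂
  rw [← hdiff n, abs_le]
  constructor <;> nlinarith [(hc n).1, (hc n).2]

/-- Consecutive ratios are at most `exp (E γⁿ)` in both directions, and these exponents sum to at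
most `E / (1 - γ)`. It keeps the normalized iterates away from `0` and `∞`. -/
theorem _root_.exp_bounds_of_geometric_ratio {a : ℕ → ℝ} {E γ : ℝ} (hE : 0 ≤ E) (hγ0 : 0 ≤ γ)
    (hγ1 : γ < 1) (ha : ∀ n, 0 < a n) (h0 : a 0 = 1)
    (h1 : ∀ n, a (n + 1) ≤ (1 + E * γ ^ n) * a n) (h2 : ∀ n, a n ≤ (1 + E * γ ^ n) * a (n + 1))
    (n : ℕ) : Real.exp (-(E / (1 - γ))) ≤ a n ∧ a n ≤ Real.exp (E / (1 - γ)) := by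
  have hexp : ∀ n : ℕ, 1 + E * γ ^ n ≤ Real.exp (E * γ ^ n) := fun n => by
    linarith [Real.add_one_le_exp (E * γ ^ n)]
  have key : ∀ n, Real.exp (-(E * ∑ k ∈ Finset.range n, γ ^ k)) ≤ a n ∧
      a n ≤ Real.exp (E * ∑ k ∈ Finset.range n, γ ^ k) := by
    intro n
    induction n with
    | zero => simp [h0]
    | succ n ih =>
      rw [Finset.sum_range_succ, mul_add, neg_add, Real.exp_add, Real.exp_add]
      constructor
      · have := (ih.1.trans (h2 n)).trans (mul_le_mul_of_nonneg_right (hexp n) (ha _).le)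
        calc _ ≤ Real.exp (E * γ ^ n) * a (n + 1) * Real.exp (-(E * γ ^ n)) :=
              mul_le_mul_of_nonneg_right this (Real.exp_pos _).le
          _ = (Real.exp (E * γ ^ n) * Real.exp (-(E * γ ^ n))) * a (n + 1) := by ring
          _ = a (n + 1) := by rw [← Real.exp_add]; simp
      · calc a (n + 1) ≤ Real.exp (E * γ ^ n) * a n :=
              (h1 n).trans (mul_le_mul_of_nonneg_right (hexp n) (ha _).le)
          _ ≤ Real.exp (E * γ ^ n) * _ := mul_le_mul_of_nonneg_left ih.2 (Real.exp_pos _).le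
          _ = _ := mul_comm _ _
  have hsum : E * ∑ k ∈ Finset.range n, γ ^ k ≤ E / (1 - γ) := by
    rw [div_eq_mul_inv]
    refine mul_le_mul_of_nonneg_left ?_ hE
    rw [← tsum_geometric_of_lt_one hγ0 hγ1]
    exact (summable_geometric_of_lt_one hγ0 hγ1).sum_le_tsum _ fun i _ => by positivity
  exact ⟨(Real.exp_le_exp.2 (neg_le_neg hsum)).trans (key n).1,
    (key n).2.trans (Real.exp_le_exp.2 hsum)⟩

/-- Existence of a positive eigenfunction. -/
theorem exists_eigenfunction (H : R.IsContractedCone D A A' δ) :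
    ∃ l : ℝ, 0 < l ∧ ∃ h ∈ distortionCone D A', (∀ y, 0 < h y) ∧ R.transfer ℝ h = l • h := by
  inhabit Y
  have h1 := H.one_mem
  have hB1 := H.map_mem _ (H.mem_of_mem h1)
  have hone : ∀ y, 0 < (1 : C(Y, ℝ)) y := fun y => one_pos
  -- Comparing `B 1` with `1` makes `Bⁿ⁺¹ 1` nearly `l Bⁿ 1`, with geometrically small relative
  -- error. This identifies the eigenvalue and makes `l⁻ⁿ Bⁿ 1` a Cauchy sequence.
  obtain ⟨m, M, hm0, hm, hM⟩ := H.exists_bracket hB1 h1 (transfer_pos hone) hone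
  obtain ⟨l, hml, hlM, hl⟩ := H.exists_abs_sub_le (H.mem_of_mem h1) hone hm hM
  have hl0 : 0 < l := hm0.trans_le hml
  set B := R.transfer ℝ with hB
  have hδ := H.δ_pos
  have hδ1 := H.δ_lt_one
  let u : ℕ → C(Y, ℝ) := fun n => (l⁻¹) ^ n • (B ^ n) 1
  have hu0 : ∀ n y, 0 < u n y := fun n y =>
    mul_pos (by positivity) (transfer_pow_pos hone n y)
  have hBu : ∀ n, B (u n) = l • u (n + 1) := by
    intro n
    simp only [u, map_smul, pow_succ' B, smul_smul]
    congr 1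
    rw [pow_succ]
    field_simp
  have hdist : ∀ n y, |u (n + 1) y - u n y| ≤ (M - m) / l * (1 - δ) ^ n * u n y := by
    intro n y
    have := hl n y
    have e : u (n + 1) y - u n y = (l⁻¹) ^ (n + 1) * ((B ^ n) (B 1) y - l * (B ^ n) 1 y) := by
      simp only [u, ContinuousMap.smul_apply, smul_eq_mul, pow_succ B, mul_apply_eq_comp]
      rw [pow_succ]
      field_simp
    rw [e, abs_mul, abs_of_pos (by positivity)]
    calc _ ≤ (l⁻¹) ^ (n + 1) * ((M - m) * (1 - δ) ^ n * (B ^ n) 1 y) :=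
          mul_le_mul_of_nonneg_left this (by positivity)
      _ = _ := by
        simp only [u, ContinuousMap.smul_apply, smul_eq_mul]
        rw [pow_succ]
        field_simp
  have hlow : ∀ n y, m * u n y ≤ l * u (n + 1) y := by
    intro n y
    have e : ∀ y, (m • (1 : C(Y, ℝ))) y ≤ B 1 y := fun y => by
      have := hm.1 y
      simp only [ContinuousMap.sub_apply] at this
      linarith
    have := transfer_pow_mono (R := R) e n y
    rw [← hB, map_smul] at this
    simp only [ContinuousMap.smul_apply, smul_eq_mul] at this
    have e2 : l * u (n + 1) y = (l⁻¹) ^ n * (B ^ n) (B 1) y := by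
      simp only [u, ContinuousMap.smul_apply, smul_eq_mul, pow_succ B, mul_apply_eq_comp]
      rw [pow_succ]
      field_simp
    rw [e2]
    calc m * u n y = (l⁻¹) ^ n * (m * (B ^ n) 1 y) := by
          simp only [u, ContinuousMap.smul_apply, smul_eq_mul]; ring
      _ ≤ _ := mul_le_mul_of_nonneg_left this (by positivity)
  have hMm : 0 ≤ M - m := by linarith
  have hγ0 : 0 ≤ 1 - δ := by linarith
  -- The constant `(M - m) / m` serves both ratio bounds: for the reverse one, `hlow` costs a factor
  -- `l / m`.
  have hEle : (M - m) / l ≤ (M - m) / m := div_le_div_of_nonneg_left hMm hm0 hml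
  have hbd : ∀ n y, Real.exp (-((M - m) / m / (1 - (1 - δ)))) ≤ u n y ∧
      u n y ≤ Real.exp ((M - m) / m / (1 - (1 - δ))) := by
    intro n y
    refine exp_bounds_of_geometric_ratio (a := fun n => u n y) (by positivity) hγ0 (by linarith)
      (fun n => hu0 n y) (by simp [u]) (fun n => ?_) (fun n => ?_) n
    · have k := (abs_le.1 (hdist n y)).2
      have : (M - m) / l * (1 - δ) ^ n * u n y ≤ (M - m) / m * (1 - δ) ^ n * u n y := by
        have := (hu0 n y).le
        gcongr
      linarith
    · have k := (abs_le.1 (hdist n y)).1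
      have : (M - m) / l * (1 - δ) ^ n * u n y ≤ (M - m) / m * (1 - δ) ^ n * u (n + 1) y := by
        have e : u n y ≤ l / m * u (n + 1) y := by
          rw [div_mul_eq_mul_div, le_div_iff₀ hm0]
          linarith [hlow n y]
        calc _ ≤ (M - m) / l * (1 - δ) ^ n * (l / m * u (n + 1) y) :=
              mul_le_mul_of_nonneg_left e (by positivity)
          _ = _ := by field_simp
      linarith
  set S := Real.exp ((M - m) / m / (1 - (1 - δ)))
  have hcau : CauchySeq u := by
    refine cauchySeq_of_le_geometric (1 - δ) ((M - m) / l * S) (by linarith) fun n => ?_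
    rw [dist_comm, dist_eq_norm, ContinuousMap.norm_le _ (by positivity)]
    intro y
    rw [ContinuousMap.sub_apply, Real.norm_eq_abs]
    refine (hdist n y).trans ?_
    calc _ ≤ (M - m) / l * (1 - δ) ^ n * S :=
          mul_le_mul_of_nonneg_left (hbd n y).2 (by positivity)
      _ = _ := by ring
  obtain ⟨h, hh⟩ := cauchySeq_tendsto_of_complete hcau
  have hmem : ∀ n, u (n + 1) ∈ distortionCone D A' := by
    have hmem : ∀ n, u n ∈ distortionCone D A' := by
      intro n
      induction n with
      | zero => simpa [u] using h1
      | succ n ih =>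
        have := distortionCone_smul (H.map_mem _ (H.mem_of_mem ih)) (inv_nonneg.2 hl0.le)
        rwa [← hB, hBu, smul_smul, inv_mul_cancel₀ hl0.ne', one_smul] at this
    exact fun n => hmem _
  refine ⟨l, hl0, h, isClosed_distortionCone.mem_of_tendsto
    ((tendsto_add_atTop_iff_nat 1).2 hh) (Eventually.of_forall hmem), fun y => ?_, ?_⟩
  · have : Tendsto (fun n => u n y) atTop (𝓝 (h y)) :=
      ((continuous_eval_const y).tendsto h).comp hh
    exact (Real.exp_pos _).trans_le (ge_of_tendsto' this fun n => (hbd n y).1)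
  · refine tendsto_nhds_unique ((B.continuous.tendsto h).comp hh) ?_
    have : Tendsto (fun n => l • u (n + 1)) atTop (𝓝 (l • h)) :=
      ((tendsto_add_atTop_iff_nat 1).2 hh).const_smul l
    exact this.congr fun n => (hBu n).symm

end IsContractedCone

end Perron

end WeightedIFS

/-! ### Two facts about the spectrum -/

/-- Since `k ^ n` lies in the spectrum of `a ^ n`, the powers `(‖k‖ / l) ^ n` stay bounded. -/
theorem spectrum.norm_le_of_norm_pow_le {𝔸 : Type*} [NormedRing 𝔸] [NormedAlgebra ℂ 𝔸]
    [CompleteSpace 𝔸] {a : 𝔸} {K l : ℝ} (hl : 0 < l) (h : ∀ n : ℕ, ‖a ^ n‖ ≤ K * l ^ n) {k : ℂ}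
    (hk : k ∈ spectrum ℂ a) : ‖k‖ ≤ l := by
  by_contra! hlt
  have h1 : ∀ n : ℕ, (‖k‖ / l) ^ n ≤ K * ‖(1 : 𝔸)‖ := by
    intro n
    have e1 := spectrum.norm_le_norm_mul_of_mem (spectrum.pow_mem_pow a n hk)
    rw [div_pow, div_le_iff₀ (by positivity), ← norm_pow]
    refine e1.trans ?_
    calc _ ≤ K * l ^ n * ‖(1 : 𝔸)‖ := mul_le_mul_of_nonneg_right (h n) (norm_nonneg _)
      _ = _ := by ring
  have h2 : Tendsto (fun n : ℕ => (‖k‖ / l) ^ n) atTop atTop :=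
    tendsto_pow_atTop_atTop_of_one_lt ((one_lt_div hl).2 hlt)
  obtain ⟨n, hn⟩ := (h2.eventually_gt_atTop (K * ‖(1 : 𝔸)‖)).exists
  exact absurd (h1 n) (not_le.2 hn)

theorem ContinuousLinearMap.mem_spectrum_of_apply_eq_smul {𝕜 E : Type*} [NontriviallyNormedField 𝕜]
    [NormedAddCommGroup E] [NormedSpace 𝕜 E] {T : E →L[𝕜] E} {k : 𝕜} {v : E} (hv : v ≠ 0)
    (h : T v = k • v) : k ∈ spectrum 𝕜 T := by
  rw [spectrum.mem_iff]
  rintro ⟨u, hu⟩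
  have h2 : (u : E →L[𝕜] E) v = 0 := by
    rw [hu]
    simp [h, Algebra.algebraMap_eq_smul_one]
  have h3 : (↑u⁻¹ * ↑u : E →L[𝕜] E) v = 0 := by
    rw [mul_apply_eq_comp, h2, map_zero]
  rw [Units.inv_mul] at h3
  exact hv h3

/-! ### Convergence of the normalized iterates -/

namespace WeightedIFS

section Convergence

variable {Y ι : Type*} [TopologicalSpace Y] [CompactSpace Y] [Fintype ι]
variable {R : WeightedIFS Y ι} {D : Y → Y → ℝ}

theorem transfer_pow_eigenfunction {l : ℝ} {h : C(Y, ℝ)} (hh : R.transfer ℝ h = l • h) (n : ℕ) :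
    (R.transfer ℝ ^ n) h = l ^ n • h := by
  induction n with
  | zero => simp
  | succ n ih => rw [pow_succ', mul_apply_eq_comp, ih, map_smul, hh, smul_smul, pow_succ]

theorem exists_norm_smul_le {h : C(Y, ℝ)} (h0 : ∀ y, 0 < h y) :
    ∃ H : ℝ, 0 ≤ H ∧ ∀ y, 1 ≤ H * h y := by
  let g : C(Y, ℝ) := ⟨fun y => (h y)⁻¹, h.continuous.inv₀ fun y => (h0 y).ne'⟩
  refine ⟨‖g‖, norm_nonneg _, fun y => ?_⟩
  have h1 : (h y)⁻¹ ≤ ‖g‖ := (le_abs_self _).trans (g.norm_coe_le_norm y)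
  calc 1 = (h y)⁻¹ * h y := (inv_mul_cancel₀ (h0 y).ne').symm
    _ ≤ _ := mul_le_mul_of_nonneg_right h1 (h0 y).le

theorem norm_transfer_pow_apply_le {𝕜 : Type*} [RCLike 𝕜] {f : C(Y, 𝕜)} {g : C(Y, ℝ)}
    (hfg : ∀ y, ‖f y‖ ≤ g y) (n : ℕ) (y : Y) :
    ‖(R.transfer 𝕜 ^ n) f y‖ ≤ (R.transfer ℝ ^ n) g y := by
  induction n generalizing y with
  | zero => exact hfg y
  | succ n ih =>
    rw [pow_succ', pow_succ', mul_apply_eq_comp, mul_apply_eq_comp, transfer_apply, transfer_apply]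
    refine (norm_sum_le _ _).trans (Finset.sum_le_sum fun i _ => ?_)
    rw [norm_mul, RCLike.norm_ofReal, abs_of_pos (R.weight_pos i y)]
    exact mul_le_mul_of_nonneg_left (ih _) (R.weight_pos i y).le

/-- By compactness `|f|` is at most a constant times `‖f‖ h`; positivity preserves this under
iteration and `h` grows exactly like `lⁿ`. The complex case is needed for the spectral radius, the
real one for the density argument. -/
theorem exists_norm_transfer_pow_le {l : ℝ} (hl : 0 < l) {h : C(Y, ℝ)} (h0 : ∀ y, 0 < h y)
    (hh : R.transfer ℝ h = l • h) (𝕜 : Type*) [RCLike 𝕜] :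
    ∃ K : ℝ, 0 ≤ K ∧ ∀ n f, ‖(R.transfer 𝕜 ^ n) f‖ ≤ K * l ^ n * ‖f‖ := by
  obtain ⟨H, hH0, hH⟩ := exists_norm_smul_le h0
  refine ⟨H * ‖h‖, by positivity, fun n f => ?_⟩
  rw [ContinuousMap.norm_le _ (by positivity)]
  intro y
  have h1 : ∀ y, ‖f y‖ ≤ ((‖f‖ * H) • h) y := fun y => by
    refine (f.norm_coe_le_norm y).trans ?_
    simp only [ContinuousMap.smul_apply, smul_eq_mul]
    nlinarith [hH y, norm_nonneg f]
  refine (norm_transfer_pow_apply_le h1 n y).trans ?_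
  rw [map_smul, transfer_pow_eigenfunction hh]
  simp only [ContinuousMap.smul_apply, smul_eq_mul]
  have h2 : h y ≤ ‖h‖ := (le_abs_self _).trans (h.norm_coe_le_norm y)
  calc ‖f‖ * H * (l ^ n * h y) ≤ ‖f‖ * H * (l ^ n * ‖h‖) := by gcongr
    _ = _ := by ring

/-- The eigenvalue of a positive eigenfunction is the spectral radius. -/
theorem rho_eq_of_eigenfunction [Nonempty Y] {l : ℝ} (hl : 0 < l) {h : C(Y, ℝ)}
    (h0 : ∀ y, 0 < h y) (hh : R.transfer ℝ h = l • h) : R.rho = l := by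
  inhabit Y
  obtain ⟨K, hK0, hK⟩ := exists_norm_transfer_pow_le hl h0 hh ℂ
  have hupper : ∀ k ∈ spectrum ℂ (R.transfer ℂ), ‖k‖ ≤ l := fun k hk =>
    spectrum.norm_le_of_norm_pow_le hl (fun n =>
      ContinuousLinearMap.opNorm_le_bound _ (by positivity) (hK n)) hk
  have hmem : (l : ℂ) ∈ spectrum ℂ (R.transfer ℂ) := by
    let hc : C(Y, ℂ) := ⟨fun y => (h y : ℂ), by fun_prop⟩
    have h1 : R.transfer ℂ hc = (l : ℂ) • hc := by
      ext y
      have := DFunLike.congr_fun hh y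
      rw [transfer_apply] at this ⊢
      simp only [ContinuousMap.smul_apply, smul_eq_mul, RCLike.ofReal_real_eq_id, id_eq] at this
      simp only [hc, ContinuousMap.coe_mk, ContinuousMap.smul_apply, smul_eq_mul]
      have hcast := congrArg (fun t : ℝ => (t : ℂ)) this
      push_cast at hcast
      exact hcast
    refine ContinuousLinearMap.mem_spectrum_of_apply_eq_smul (v := hc) (fun h3 => ?_) h1
    have h4 := DFunLike.congr_fun h3 (default : Y)
    simp only [hc, ContinuousMap.coe_mk, ContinuousMap.zero_apply, Complex.ofReal_eq_zero] at h4
    exact (h0 default).ne' h4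
  have hsr : spectralRadius ℂ (R.transfer ℂ) = ENNReal.ofReal l := by
    apply le_antisymm
    · refine iSup₂_le fun k hk => ?_
      rw [← enorm_eq_nnnorm, ← ofReal_norm]
      exact ENNReal.ofReal_le_ofReal (hupper k hk)
    · refine le_trans ?_ (le_iSup₂ (f := fun (k : ℂ) (_ : k ∈ spectrum ℂ (R.transfer ℂ)) =>
        (‖k‖₊ : ℝ≥0∞)) (l : ℂ) hmem)
      rw [← enorm_eq_nnnorm, ← ofReal_norm, Complex.norm_real, Real.norm_eq_abs,
        abs_of_pos hl]
  rw [rho, hsr, ENNReal.toReal_ofReal hl.le]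

variable [Nonempty Y] [Nonempty ι] {A A' δ : ℝ}

/-- Bracket `g` by `h`: the iterates of `h` are `lⁿ h`, so the shrinking bracket is a uniform limit.
-/
theorem IsContractedCone.exists_tendsto_of_mem (H : R.IsContractedCone D A A' δ) {l : ℝ} (hl : 0 < l)
    {h : C(Y, ℝ)} (hmem : h ∈ distortionCone D A') (h0 : ∀ y, 0 < h y)
    (hh : R.transfer ℝ h = l • h) {g : C(Y, ℝ)} (hg : g ∈ distortionCone D A')
    (hg0 : ∀ y, 0 < g y) :
    ∃ c : ℝ, Tendsto (fun n => (l⁻¹) ^ n • (R.transfer ℝ ^ n) g) atTop (𝓝 (c • h)) := by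
  have hδ := H.δ_pos
  have hδ1 := H.δ_lt_one
  obtain ⟨m, M, hm0, hm, hM⟩ := H.exists_bracket hg hmem hg0 h0
  obtain ⟨c, hmc, hcM, hc⟩ := H.exists_abs_sub_le (H.mem_of_mem hmem) h0 hm hM
  refine ⟨c, ?_⟩
  rw [tendsto_iff_norm_sub_tendsto_zero]
  have hMm : 0 ≤ M - m := by linarith
  have hγ : 0 ≤ 1 - δ := by linarith
  have hlim : Tendsto (fun n : ℕ => (M - m) * ‖h‖ * (1 - δ) ^ n) atTop (𝓝 0) := by
    simpa using (tendsto_pow_atTop_nhds_zero_of_lt_one hγ (by linarith : 1 - δ < 1)).const_mul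
      ((M - m) * ‖h‖)
  refine squeeze_zero (fun n => norm_nonneg _) (fun n => ?_) hlim
  rw [ContinuousMap.norm_le _ (by positivity)]
  intro y
  have := hc n y
  rw [transfer_pow_eigenfunction hh] at this
  simp only [ContinuousMap.smul_apply, smul_eq_mul] at this
  have e : ((l⁻¹) ^ n • (R.transfer ℝ ^ n) g - c • h) y =
      (l⁻¹) ^ n * ((R.transfer ℝ ^ n) g y - c * (l ^ n * h y)) := by
    simp only [ContinuousMap.sub_apply, ContinuousMap.smul_apply, smul_eq_mul, inv_pow]
    field_simp
  rw [e, norm_mul, Real.norm_eq_abs, Real.norm_eq_abs, abs_of_pos (by positivity)]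
  calc _ ≤ (l⁻¹) ^ n * ((M - m) * (1 - δ) ^ n * (l ^ n * h y)) :=
        mul_le_mul_of_nonneg_left this (by positivity)
    _ = (M - m) * (1 - δ) ^ n * h y := by
      rw [inv_pow]
      field_simp
    _ ≤ (M - m) * (1 - δ) ^ n * ‖h‖ :=
      mul_le_mul_of_nonneg_left ((le_abs_self _).trans (h.norm_coe_le_norm y)) (by positivity)
    _ = _ := by ring

/-- Adding a large constant puts `g` in the cone: if `G ≥ |ℓ| / A'`, then `G x ≤ (1 + A' * D x z) *
G z ≤ exp (A' * D x z) * G z`. The constant is removed by linearity, constants being in the cone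
too. -/
theorem IsContractedCone.exists_tendsto_of_lipschitz (H : R.IsContractedCone D A A' δ) {l : ℝ}
    (hl : 0 < l) {h : C(Y, ℝ)} (hmem : h ∈ distortionCone D A') (h0 : ∀ y, 0 < h y)
    (hh : R.transfer ℝ h = l • h) {g : C(Y, ℝ)} (hg : ∃ ℓ, ∀ x z, |g x - g z| ≤ ℓ * D x z) :
    ∃ c : ℝ, Tendsto (fun n => (l⁻¹) ^ n • (R.transfer ℝ ^ n) g) atTop (𝓝 (c • h)) := by
  obtain ⟨ℓ, hℓ⟩ := hg
  have hA' := H.pos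
  set t : ℝ := ‖g‖ + |ℓ| / A' + 1 with ht
  have hpos : ∀ y, |ℓ| / A' + 1 ≤ (g + t • (1 : C(Y, ℝ))) y := by
    intro y
    have := (abs_le.1 (g.norm_coe_le_norm y)).1
    simp only [ContinuousMap.add_apply, ContinuousMap.smul_apply, ContinuousMap.one_apply,
      smul_eq_mul, mul_one, ht]
    linarith
  have hpos' : ∀ y, 0 < (g + t • (1 : C(Y, ℝ))) y := fun y =>
    lt_of_lt_of_le (by positivity) (hpos y)
  have hcone : g + t • (1 : C(Y, ℝ)) ∈ distortionCone D A' := by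
    refine ⟨fun y => (hpos' y).le, fun x z => ?_⟩
    have h1 : (g + t • (1 : C(Y, ℝ))) x - (g + t • (1 : C(Y, ℝ))) z = g x - g z := by
      simp
    have h2 := (le_abs_self _).trans (hℓ x z)
    have h3 := H.gauge_nonneg x z
    have h4 : ℓ * D x z ≤ A' * D x z * (g + t • (1 : C(Y, ℝ))) z := by
      have : |ℓ| ≤ A' * (g + t • (1 : C(Y, ℝ))) z := by
        have := mul_le_mul_of_nonneg_left (hpos z) hA'.le
        rw [mul_add, mul_div_cancel₀ _ hA'.ne'] at this
        linarith
      nlinarith [le_abs_self ℓ]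
    have h5 := mul_le_mul_of_nonneg_right (Real.add_one_le_exp (A' * D x z)) (hpos' z).le
    linarith
  obtain ⟨c₁, hc₁⟩ := H.exists_tendsto_of_mem hl hmem h0 hh hcone hpos'
  obtain ⟨c₂, hc₂⟩ := H.exists_tendsto_of_mem hl hmem h0 hh H.one_mem fun y => one_pos
  refine ⟨c₁ - t * c₂, ?_⟩
  have := hc₁.sub (hc₂.const_smul t)
  rw [smul_smul, ← sub_smul] at this
  refine this.congr fun n => ?_
  simp only [map_add, map_smul, smul_add]
  rw [smul_comm t]
  simp

/-- **Ruelle–Perron–Frobenius theorem**: the normalized iterates of the transfer operator converge to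
the projection on the line spanned by a positive eigenfunction. -/
theorem IsContractedCone.exists_tendsto (H : R.IsContractedCone D A A' δ)
    (hD : Dense {g : C(Y, ℝ) | ∃ ℓ, ∀ x z, |g x - g z| ≤ ℓ * D x z}) :
    ∃ l : ℝ, 0 < l ∧ ∃ h : C(Y, ℝ), (∀ y, 0 < h y) ∧ R.transfer ℝ h = l • h ∧
      ∀ f, ∃ c : ℝ, Tendsto (fun n => (l⁻¹) ^ n • (R.transfer ℝ ^ n) f) atTop (𝓝 (c • h)) := by
  obtain ⟨l, hl, h, hmem, h0, hh⟩ := H.exists_eigenfunction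
  refine ⟨l, hl, h, h0, hh, fun f => ?_⟩
  obtain ⟨K, hK0, hK⟩ := exists_norm_transfer_pow_le hl h0 hh ℝ
  have hbd : ∀ n f, ‖(l⁻¹) ^ n • (R.transfer ℝ ^ n) f‖ ≤ K * ‖f‖ := by
    intro n f
    rw [norm_smul, Real.norm_eq_abs, abs_of_pos (by positivity)]
    calc _ ≤ (l⁻¹) ^ n * (K * l ^ n * ‖f‖) := mul_le_mul_of_nonneg_left (hK n f) (by positivity)
      _ = _ := by rw [inv_pow]; field_simp
  have hdiff : ∀ n g, (l⁻¹) ^ n • (R.transfer ℝ ^ n) f - (l⁻¹) ^ n • (R.transfer ℝ ^ n) g =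
      (l⁻¹) ^ n • (R.transfer ℝ ^ n) (f - g) := fun n g => by rw [map_sub, smul_sub]
  have happrox : ∀ ε > 0, ∃ g : C(Y, ℝ), (∃ ℓ, ∀ x z, |g x - g z| ≤ ℓ * D x z) ∧
      K * ‖f - g‖ < ε := by
    intro ε hε
    obtain ⟨g, hg, hfg⟩ := Metric.dense_iff.1 hD f (ε / (K + 1)) (by positivity)
    refine ⟨g, hfg, ?_⟩
    rw [Metric.mem_ball, dist_comm, dist_eq_norm, lt_div_iff₀ (by positivity)] at hg
    nlinarith [norm_nonneg (f - g)]
  have hcau : CauchySeq fun n => (l⁻¹) ^ n • (R.transfer ℝ ^ n) f := by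
    rw [Metric.cauchySeq_iff']
    intro ε hε
    obtain ⟨g, hgL, hfg⟩ := happrox (ε / 3) (by positivity)
    obtain ⟨c, hc⟩ := H.exists_tendsto_of_lipschitz hl hmem h0 hh hgL
    obtain ⟨N, hN⟩ := Metric.cauchySeq_iff'.1 hc.cauchySeq (ε / 3) (by positivity)
    refine ⟨N, fun n hn => ?_⟩
    have e : ∀ n, dist ((l⁻¹) ^ n • (R.transfer ℝ ^ n) f) ((l⁻¹) ^ n • (R.transfer ℝ ^ n) g) <
        ε / 3 := fun n => by
      rw [dist_eq_norm, hdiff]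
      exact (hbd n _).trans_lt hfg
    have e1 := e n
    have e2 := e N
    rw [dist_comm] at e2
    have e3 := hN n hn
    have e4 := dist_triangle4 ((l⁻¹) ^ n • (R.transfer ℝ ^ n) f)
      ((l⁻¹) ^ n • (R.transfer ℝ ^ n) g) ((l⁻¹) ^ N • (R.transfer ℝ ^ N) g)
      ((l⁻¹) ^ N • (R.transfer ℝ ^ N) f)
    linarith
  obtain ⟨u, hu⟩ := cauchySeq_tendsto_of_complete hcau
  -- The limit is approximated by limits for Lipschitz functions, which lie on the line of `h`; the
  -- line is closed.
  have hclosed : IsClosed (Submodule.span ℝ {h} : Set C(Y, ℝ)) :=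
    Submodule.closed_of_finiteDimensional _
  have hspan : u ∈ (Submodule.span ℝ {h} : Set C(Y, ℝ)) := by
    rw [← hclosed.closure_eq, Metric.mem_closure_iff]
    intro ε hε
    obtain ⟨g, hgL, hfg⟩ := happrox (ε / 2) (by positivity)
    obtain ⟨c, hc⟩ := H.exists_tendsto_of_lipschitz hl hmem h0 hh hgL
    refine ⟨c • h, Submodule.smul_mem _ _ (Submodule.mem_span_singleton_self h), ?_⟩
    have : dist u (c • h) ≤ ε / 2 := by
      refine le_of_tendsto (hu.dist hc) (Eventually.of_forall fun n => ?_)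
      rw [dist_eq_norm, hdiff]
      exact (hbd n _).trans hfg.le
    linarith
  obtain ⟨c, rfl⟩ := Submodule.mem_span_singleton.1 hspan
  exact ⟨c, hu⟩

end Convergence

end WeightedIFS

/-! ### The eigenmeasure -/

open CompactlySupported in
/-- The Riesz–Markov–Kakutani theorem for a normalized positive functional on a compact space. -/
theorem exists_probabilityMeasure_integral_eq {Y : Type*} [TopologicalSpace Y] [CompactSpace Y]
    [T2Space Y] [MeasurableSpace Y] [BorelSpace Y] (φ : C(Y, ℝ) →ₗ[ℝ] ℝ)
    (hφ : ∀ f, 0 ≤ f → 0 ≤ φ f) (hφ1 : φ 1 = 1) :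
    ∃ μ : ProbabilityMeasure Y, ∀ f : C(Y, ℝ), ∫ y, f y ∂(μ : Measure Y) = φ f := by
  let Λ₀ : C_c(Y, ℝ) →ₗ[ℝ] ℝ :=
    { toFun := fun f => φ f.toContinuousMap
      map_add' := fun f g => φ.map_add f.toContinuousMap g.toContinuousMap
      map_smul' := fun a f => φ.map_smul a f.toContinuousMap }
  let Λ : C_c(Y, ℝ) →ₚ[ℝ] ℝ := PositiveLinearMap.mk₀ Λ₀ fun f hf => hφ f.toContinuousMap hf
  let one : C_c(Y, ℝ) := CompactlySupportedContinuousMap.continuousMapEquiv (1 : C(Y, ℝ))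
  have hinteg : ∀ f : C(Y, ℝ), ∫ y, f y ∂(RealRMK.rieszMeasure Λ) = φ f := fun f =>
    RealRMK.integral_rieszMeasure Λ (CompactlySupportedContinuousMap.continuousMapEquiv f)
  have hfin : RealRMK.rieszMeasure Λ Set.univ < ∞ := by
    refine (RealRMK.rieszMeasure_le_of_eq_one Λ (f := one) (fun x => zero_le_one)
      isCompact_univ fun x _ => rfl).trans_lt ENNReal.ofReal_lt_top
  have h1 := hinteg 1
  simp only [ContinuousMap.one_apply, integral_const, smul_eq_mul, mul_one, hφ1, Measure.real] at h1
  have hprob : IsProbabilityMeasure (RealRMK.rieszMeasure Λ) := by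
    refine ⟨?_⟩
    rw [← ENNReal.toReal_eq_one_iff, h1]
  exact ⟨⟨RealRMK.rieszMeasure Λ, hprob⟩, hinteg⟩

namespace WeightedIFS

section Eigenmeasure

variable {Y ι : Type*} [TopologicalSpace Y] [CompactSpace Y] [Fintype ι] [Nonempty Y]
variable {R : WeightedIFS Y ι}

/-- Convergence of the normalized iterates yields existence and uniqueness of the Perron pair. -/
theorem existsUnique_isPerronPair_of_tendsto [T2Space Y] [HasOuterApproxClosed Y]
    [MeasurableSpace Y] [BorelSpace Y] {l : ℝ} (hl : 0 < l) {h : C(Y, ℝ)} (h0 : ∀ y, 0 < h y)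
    (hh : R.transfer ℝ h = l • h)
    (hconv : ∀ f, ∃ c : ℝ,
      Tendsto (fun n => (l⁻¹) ^ n • (R.transfer ℝ ^ n) f) atTop (𝓝 (c • h))) :
    ∃! p : C(Y, ℝ) × ProbabilityMeasure Y, R.IsPerronPair p.1 p.2 := by
  inhabit Y
  have hrho : R.rho = l := rho_eq_of_eigenfunction hl h0 hh
  set B := R.transfer ℝ with hB
  choose c hc using hconv
  have hcancel : ∀ {a b : ℝ}, a • h = b • h → a = b := fun {a b} e => by
    have := DFunLike.congr_fun e (default : Y)
    exact mul_right_cancel₀ (h0 default).ne' this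
  have hcu : ∀ {f a}, Tendsto (fun n => (l⁻¹) ^ n • (B ^ n) f) atTop (𝓝 (a • h)) → c f = a :=
    fun {f a} hf => hcancel (tendsto_nhds_unique (hc f) hf)
  have hcadd : ∀ f g, c (f + g) = c f + c g := fun f g => hcu <| by
    rw [add_smul]
    refine ((hc f).add (hc g)).congr fun n => ?_
    rw [map_add, smul_add]
  have hcsmul : ∀ (a : ℝ) f, c (a • f) = a * c f := fun a f => hcu <| by
    rw [mul_smul]
    refine ((hc f).const_smul a).congr fun n => ?_
    rw [map_smul, smul_comm]
  have hcfix : ∀ f, B f = l • f → c f • h = f := fun f hf => by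
    refine tendsto_nhds_unique (hc f) (tendsto_const_nhds.congr fun n => ?_)
    rw [transfer_pow_eigenfunction hf, smul_smul, ← mul_pow, inv_mul_cancel₀ hl.ne', one_pow,
      one_smul]
  have hch : c h = 1 := hcancel (by rw [hcfix h hh, one_smul])
  have hcnonneg : ∀ f : C(Y, ℝ), 0 ≤ f → 0 ≤ c f := fun f hf => by
    have h1 : Tendsto (fun n => ((l⁻¹) ^ n • (B ^ n) f) default) atTop (𝓝 ((c f • h) default)) :=
      ((continuous_eval_const (default : Y)).tendsto _).comp (hc f)
    have h2 : 0 ≤ c f * h default := ge_of_tendsto' h1 fun n => by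
      have := transfer_pow_mono (R := R) (f := 0) (g := f) (fun y => hf y) n default
      rw [map_zero] at this
      exact mul_nonneg (by positivity) this
    exact nonneg_of_mul_nonneg_left h2 (h0 default)
  have hcB : ∀ f, c (B f) = l * c f := fun f => hcu <| by
    rw [mul_smul]
    refine (((tendsto_add_atTop_iff_nat 1).2 (hc f)).const_smul l).congr fun n => ?_
    rw [pow_succ B, mul_apply_eq_comp, smul_smul, pow_succ]
    congr 1
    field_simp
  -- From `h ≤ ‖h‖ · 1` and positivity, `1 = c h ≤ ‖h‖ * c 1`.
  have hc1 : 0 < c 1 := by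
    have h1 : 0 ≤ c (‖h‖ • (1 : C(Y, ℝ)) + (-1 : ℝ) • h) := hcnonneg _ fun y => by
      have : h y ≤ ‖h‖ := (le_abs_self _).trans (h.norm_coe_le_norm y)
      simpa using this
    rw [hcadd, hcsmul, hcsmul, hch] at h1
    by_contra! hneg
    nlinarith [norm_nonneg h]
  let φ : C(Y, ℝ) →ₗ[ℝ] ℝ :=
    { toFun := fun f => c f / c 1
      map_add' := fun f g => by rw [hcadd, add_div]
      map_smul' := fun a f => by rw [hcsmul, mul_div_assoc]; rfl }
  obtain ⟨μ, hμ⟩ := exists_probabilityMeasure_integral_eq φ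
    (fun f hf => div_nonneg (hcnonneg f hf) hc1.le) (div_self hc1.ne')
  have hinteg : ∀ (ν : ProbabilityMeasure Y) (f : C(Y, ℝ)), Integrable f (ν : Measure Y) :=
    fun ν f => (BoundedContinuousFunction.mkOfCompact f).integrable (ν : Measure Y)
  -- Integrating `l⁻ⁿ Bⁿ f` against an eigenmeasure does not depend on `n`, so in the limit `∫ f dν
  -- = c f * ∫ h dν`; the case `f = 1` gives `∫ h dν = 1 / c 1`.
  have huniq : ∀ ν : ProbabilityMeasure Y,
      (∀ f : C(Y, ℝ), ∫ y, B f y ∂(ν : Measure Y) = l * ∫ y, f y ∂(ν : Measure Y)) →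
      ∀ f : C(Y, ℝ), ∫ y, f y ∂(ν : Measure Y) = c f / c 1 := by
    intro ν hν
    have h1 : ∀ n (f : C(Y, ℝ)), ∫ y, ((l⁻¹) ^ n • (B ^ n) f) y ∂(ν : Measure Y) =
        ∫ y, f y ∂(ν : Measure Y) := by
      intro n f
      simp only [ContinuousMap.smul_apply, smul_eq_mul, integral_const_mul]
      have : ∫ y, (B ^ n) f y ∂(ν : Measure Y) = l ^ n * ∫ y, f y ∂(ν : Measure Y) := by
        induction n with
        | zero => simp
        | succ n ih => rw [pow_succ', mul_apply_eq_comp, hν, ih, pow_succ]; ring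
      rw [this, ← mul_assoc, ← mul_pow, inv_mul_cancel₀ hl.ne', one_pow, one_mul]
    have hcontI : Continuous fun f : C(Y, ℝ) => ∫ y, f y ∂(ν : Measure Y) := by
      refine LipschitzWith.continuous (K := 1) (LipschitzWith.of_dist_le_mul fun f g => ?_)
      rw [dist_eq_norm, ← integral_sub (hinteg ν f) (hinteg ν g), NNReal.coe_one, one_mul]
      have := norm_integral_le_of_norm_le_const (μ := (ν : Measure Y)) (C := dist f g)
        (f := fun y => f y - g y)
        (Eventually.of_forall fun y => by
          rw [← dist_eq_norm]; exact ContinuousMap.dist_apply_le_dist y)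
      simpa using this
    have h2 : ∀ f : C(Y, ℝ), ∫ y, f y ∂(ν : Measure Y) = c f * ∫ y, h y ∂(ν : Measure Y) := by
      intro f
      have h3 := (hcontI.tendsto _).comp (hc f)
      have h4 : ∫ y, (c f • h) y ∂(ν : Measure Y) = c f * ∫ y, h y ∂(ν : Measure Y) := by
        simp only [ContinuousMap.smul_apply, smul_eq_mul, integral_const_mul]
      rw [← h4]
      exact tendsto_nhds_unique (tendsto_const_nhds.congr fun n => (h1 n f).symm) h3
    intro f
    have h5 := h2 1
    simp only [ContinuousMap.one_apply, integral_const, probReal_univ, smul_eq_mul, mul_one] at h5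
    rw [h2 f, eq_div_iff hc1.ne', mul_assoc, mul_comm _ (c 1), ← h5, mul_one]
  refine ⟨(c 1 • h, μ), ⟨fun y => mul_pos hc1 (h0 y), ?_, fun f => ?_, ?_⟩, ?_⟩
  · rw [hrho, map_smul, ← hB, hh, smul_comm]
  · rw [hrho, hμ, ← hB, hμ]
    change c (B f) / c 1 = l * (c f / c 1)
    rw [hcB, mul_div_assoc]
  · rw [hμ]
    change c (c 1 • h) / c 1 = 1
    rw [hcsmul, hch, mul_one, div_self hc1.ne']
  · rintro ⟨g, ν⟩ ⟨_, hgB, hν, hnorm⟩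
    rw [hrho, ← hB] at hgB hν
    simp only at hgB hν hnorm
    have hνint := huniq ν hν
    have e1 : c g = c 1 := by
      rw [hνint, div_eq_one_iff_eq hc1.ne'] at hnorm
      exact hnorm
    have e2 : g = c 1 • h := by rw [← e1, hcfix g hgB]
    have e3 : ν = μ := by
      refine Subtype.ext (show (ν : Measure Y) = (μ : Measure Y) from ?_)
      refine ext_of_forall_integral_eq_of_IsFiniteMeasure fun f => ?_
      exact (hνint f.toContinuousMap).trans (hμ f.toContinuousMap).symm
    rw [e2, e3]

/-- The Perron–Frobenius theorem for systems with bounded distortion. -/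
theorem HasBoundedDistortion.rho_pos_and_existsUnique [Nonempty ι] [T2Space Y]
    [HasOuterApproxClosed Y] [MeasurableSpace Y] [BorelSpace Y] {D : Y → Y → ℝ} {κ C : ℝ}
    (hR : R.HasBoundedDistortion D κ C) (hκ0 : 0 ≤ κ) (hκ1 : κ < 1) (hC : 0 < C)
    (hD : Dense {g : C(Y, ℝ) | ∃ ℓ, ∀ x z, |g x - g z| ≤ ℓ * D x z}) :
    0 < R.rho ∧ ∃! p : C(Y, ℝ) × ProbabilityMeasure Y, R.IsPerronPair p.1 p.2 := by
  obtain ⟨A, A', δ, H⟩ := hR.exists_isContractedCone hκ0 hκ1 hC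
  obtain ⟨l, hl, h, h0, hh, hconv⟩ := H.exists_tendsto hD
  exact ⟨by rwa [rho_eq_of_eigenfunction hl h0 hh],
    existsUnique_isPerronPair_of_tendsto hl h0 hh hconv⟩

end Eigenmeasure

end WeightedIFS

/-! ### The symbolic space -/

section Symbolic

variable {d : ℕ} {θ : ℝ}

theorem symDist_nonneg (h0 : 0 < θ) (x z : SymbolicSpace d) : 0 ≤ symDist θ x z := by
  unfold symDist
  split_ifs <;> positivity

theorem symDist_le_one (h0 : 0 < θ) (h1 : θ < 1) (x z : SymbolicSpace d) : symDist θ x z ≤ 1 := by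
  unfold symDist
  split_ifs
  · exact zero_le_one
  · exact pow_le_one₀ h0.le h1.le

theorem symDist_comm (x z : SymbolicSpace d) : symDist θ x z = symDist θ z x := by
  rcases eq_or_ne x z with rfl | h
  · rfl
  · rw [symDist, symDist, if_neg h, if_neg h.symm, PiNat.firstDiff_comm]

theorem pow_le_symDist (h0 : 0 < θ) (h1 : θ < 1) {x z : SymbolicSpace d} {n : ℕ}
    (h : x n ≠ z n) : θ ^ (n + 1) ≤ symDist θ x z := by
  have hne : x ≠ z := fun e => h (by rw [e])
  rw [symDist, if_neg hne]
  refine pow_le_pow_of_le_one h0.le h1.le (Nat.succ_le_succ ?_)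
  by_contra! hlt
  exact h (PiNat.apply_eq_of_lt_firstDiff hlt)

/-- A contraction lengthens the common prefix. -/
theorem prefix_succ_of_symDist_le (h0 : 0 < θ) (h1 : θ < 1) {L : ℝ} (hL1 : L < 1)
    {x z x' z' : SymbolicSpace d} (h : symDist θ x' z' ≤ L * symDist θ x z) {n : ℕ}
    (hxz : ∀ i < n, x i = z i) : ∀ i < n + 1, x' i = z' i := by
  intro i hi
  by_contra hne
  have h2 := pow_le_symDist h0 h1 hne
  -- Agreement at the indices `0, …, n - 1` puts the first difference at 1-based position at least
  -- `n + 1`. A difference of `x'` and `z'` at some `i ≤ n` would need distance at least `θ ^ (n +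
  -- 1)`, which the factor `L < 1` excludes.
  have h3 : symDist θ x z ≤ θ ^ (n + 1) := by
    unfold symDist
    split_ifs with he
    · positivity
    · refine pow_le_pow_of_le_one h0.le h1.le (Nat.succ_le_succ ?_)
      by_contra! hlt
      exact PiNat.apply_firstDiff_ne he (hxz _ hlt)
  have h4 : θ ^ (n + 1) ≤ θ ^ (i + 1) := pow_le_pow_of_le_one h0.le h1.le hi
  have h5 : 0 < θ ^ (i + 1) := by positivity
  rcases (symDist_nonneg h0 x z).eq_or_lt with h6 | h6
  · rw [← h6, mul_zero] at h
    linarith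
  · nlinarith

theorem concat_tail (x : SymbolicSpace d) : concat (x 0) (fun n => x (n + 1)) = x := by
  funext n
  cases n <;> rfl

/-- Stone–Weierstrass: functions Lipschitz for a gauge form a subalgebra, whether or not the gauge
is a metric. -/
theorem dense_gaugeLipschitz {Y : Type*} [TopologicalSpace Y] [CompactSpace Y] {D : Y → Y → ℝ}
    (hsep : ∀ x y, x ≠ y → ∃ g : C(Y, ℝ), (∃ ℓ, ∀ x z, |g x - g z| ≤ ℓ * D x z) ∧ g x ≠ g y) :
    Dense {g : C(Y, ℝ) | ∃ ℓ, ∀ x z, |g x - g z| ≤ ℓ * D x z} := by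
  let 𝒜 : Subalgebra ℝ C(Y, ℝ) :=
    { carrier := {g : C(Y, ℝ) | ∃ ℓ, ∀ x z, |g x - g z| ≤ ℓ * D x z}
      mul_mem' := by
        rintro f g ⟨a, ha⟩ ⟨b, hb⟩
        refine ⟨‖f‖ * b + ‖g‖ * a, fun x z => ?_⟩
        have e : (f * g) x - (f * g) z = f x * (g x - g z) + g z * (f x - f z) := by
          simp only [ContinuousMap.mul_apply]; ring
        rw [e]
        refine (abs_add_le _ _).trans ?_
        rw [abs_mul, abs_mul, add_mul]
        have e1 : |f x| ≤ ‖f‖ := f.norm_coe_le_norm x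
        have e2 : |g z| ≤ ‖g‖ := g.norm_coe_le_norm z
        have e3 := mul_le_mul e1 (hb x z) (abs_nonneg _) (norm_nonneg _)
        have e4 := mul_le_mul e2 (ha x z) (abs_nonneg _) (norm_nonneg _)
        linarith
      add_mem' := by
        rintro f g ⟨a, ha⟩ ⟨b, hb⟩
        refine ⟨a + b, fun x z => ?_⟩
        have e : (f + g) x - (f + g) z = (f x - f z) + (g x - g z) := by
          simp only [ContinuousMap.add_apply]; ring
        rw [e, add_mul]
        exact (abs_add_le _ _).trans (add_le_add (ha x z) (hb x z))
      algebraMap_mem' := fun a => ⟨0, fun x z => by simp⟩ }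
  have hA : 𝒜.SeparatesPoints := fun x y hxy => by
    obtain ⟨g, hg, hne⟩ := hsep x y hxy
    exact ⟨g, ⟨g, hg, rfl⟩, hne⟩
  have htop := ContinuousMap.subalgebra_topologicalClosure_eq_top_of_separatesPoints 𝒜 hA
  rw [dense_iff_closure_eq]
  exact congrArg (fun S : Subalgebra ℝ C(Y, ℝ) => (S : Set C(Y, ℝ))) htop

/-- Indicators of `{w | w n = a}` separate points, and points where such an indicator differs are at
distance at least `θ ^ (n + 1)`. -/
theorem dense_symDist_lipschitz (h0 : 0 < θ) (h1 : θ < 1) {α : ℝ} (hα : 0 < α)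
    (K : TopologicalSpace.NonemptyCompacts (SymbolicSpace d)) :
    Dense {g : C(K, ℝ) | ∃ ℓ, ∀ x z : K, |g x - g z| ≤ ℓ * symDist θ x.1 z.1 ^ α} := by
  refine dense_gaugeLipschitz fun x y hxy => ?_
  have hne : x.1 ≠ y.1 := fun e => hxy (Subtype.ext e)
  obtain ⟨n, hn⟩ := Function.ne_iff.1 hne
  let F : C(K, ℝ) := ⟨fun w => if w.1 n = x.1 n then 1 else 0,
    (continuous_of_discreteTopology (f := fun a : Fin d => if a = x.1 n then (1 : ℝ) else 0)).comp
      ((continuous_apply n).comp continuous_subtype_val)⟩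
  refine ⟨F, ⟨((θ ^ (n + 1)) ^ α)⁻¹, fun w z => ?_⟩, ?_⟩
  · have hpos : 0 < (θ ^ (n + 1)) ^ α := by positivity
    have hs := symDist_nonneg h0 w.1 z.1
    by_cases hwz : w.1 n = z.1 n
    · have : F w = F z := by simp [F, hwz]
      rw [this, sub_self, abs_zero]
      positivity
    · have e1 : |F w - F z| ≤ 1 := by
        simp only [F, ContinuousMap.coe_mk]
        split_ifs <;> simp
      refine e1.trans ?_
      rw [← div_eq_inv_mul, one_le_div hpos]
      exact Real.rpow_le_rpow (by positivity) (pow_le_symDist h0 h1 hwz) hα.le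
  · simp only [F, ContinuousMap.coe_mk, if_true]
    rw [if_neg (fun e => hn e.symm)]
    exact one_ne_zero

end Symbolic

/-! ### The system attached to a representation -/

section Representation

variable {d : ℕ} {θ : ℝ} {r : Setoid (SymbolicSpace d)} {k : Fin d → ℕ}
  {ψ : (j : Fin d) → Fin (k j) → C(SymbolicSpace d, SymbolicSpace d)}
  {V : C(SymbolicSpace d, ℝ)} {β : ℝ}

theorem IsRepresentation.exists_eq (hψ : IsRepresentation r ψ) (x : SymbolicSpace d) :
    ∃ i : Fin (k (x 0)), ψ (x 0) i (fun n => x (n + 1)) = x := by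
  have h : x ∈ {s | r s (concat (x 0) (fun n => x (n + 1)))} := by
    rw [concat_tail]
    exact r.refl x
  rw [← (hψ (x 0) (fun n => x (n + 1))).2] at h
  exact h

theorem IsRepresentation.iUnion_image_univ (hψ : IsRepresentation r ψ) :
    ⋃ p, (haarIFS ψ V β).map p '' Set.univ = Set.univ := by
  refine Set.eq_univ_of_forall fun x => ?_
  obtain ⟨i, hi⟩ := hψ.exists_eq x
  exact Set.mem_iUnion.2 ⟨⟨x 0, i⟩, _, Set.mem_univ _, hi⟩

variable {L : ℝ}

/-- To approximate `x` to depth `n + 1`, approximate its tail to depth `n` inside `K` and apply the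
map that sends the tail to `x`. -/
theorem IsRepresentation.eq_univ_of_isAttractor (hψ : IsRepresentation r ψ) (h0 : 0 < θ)
    (h1 : θ < 1) (hL1 : L < 1)
    (hL : ∀ (j : Fin d) (i : Fin (k j)) (x z : SymbolicSpace d),
      symDist θ (ψ j i x) (ψ j i z) ≤ L * symDist θ x z)
    {K : TopologicalSpace.NonemptyCompacts (SymbolicSpace d)}
    (hK : (haarIFS ψ V β).IsAttractor K) : (K : Set (SymbolicSpace d)) = Set.univ := by
  have happrox : ∀ n (x : SymbolicSpace d), ∃ y ∈ K, ∀ i < n, x i = y i := by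
    intro n
    induction n with
    | zero =>
      intro x
      obtain ⟨y, hy⟩ := K.nonempty
      exact ⟨y, hy, fun i hi => absurd hi (Nat.not_lt_zero i)⟩
    | succ n ih =>
      intro x
      obtain ⟨i, hi⟩ := hψ.exists_eq x
      obtain ⟨y, hy, hxy⟩ := ih fun n => x (n + 1)
      refine ⟨ψ (x 0) i y, hK.map_mem ⟨x 0, i⟩ ⟨y, hy⟩, ?_⟩
      have := prefix_succ_of_symDist_le h0 h1 hL1 (hL (x 0) i _ _) hxy
      rwa [hi] at this
  refine Set.eq_univ_of_forall fun x => ?_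
  choose y hyK hy using fun n => happrox n x
  refine K.isCompact.isClosed.mem_of_tendsto (f := y) (b := atTop) ?_ (Eventually.of_forall hyK)
  refine tendsto_pi_nhds.2 fun i => tendsto_const_nhds.congr' ?_
  filter_upwards [eventually_gt_atTop i] with n hn
  exact hy n i hn

theorem IsRepresentation.existsUnique_isAttractor (hd : 0 < d) (hψ : IsRepresentation r ψ)
    (h0 : 0 < θ) (h1 : θ < 1) (hL1 : L < 1)
    (hL : ∀ (j : Fin d) (i : Fin (k j)) (x z : SymbolicSpace d),
      symDist θ (ψ j i x) (ψ j i z) ≤ L * symDist θ x z) :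
    ∃! K : TopologicalSpace.NonemptyCompacts (SymbolicSpace d), (haarIFS ψ V β).IsAttractor K := by
  have : Nonempty (SymbolicSpace d) := ⟨fun _ => ⟨0, hd⟩⟩
  refine ⟨⊤, ?_, fun K hK => ?_⟩
  · simpa [WeightedIFS.IsAttractor] using hψ.iUnion_image_univ (V := V) (β := β)
  · exact SetLike.coe_injective (by
      simpa using hψ.eq_univ_of_isAttractor h0 h1 hL1 hL hK)

/-- The integrand is at most `|β| |C| t ^ (α - 1)`, which is integrable at `0` because `α > 0`. -/
theorem haarIFS_hasDiniWeights (h0 : 0 < θ) (hL1 : L < 1)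
    (hL : ∀ (j : Fin d) (i : Fin (k j)) (x z : SymbolicSpace d),
      symDist θ (ψ j i x) (ψ j i z) ≤ L * symDist θ x z)
    {α C : ℝ} (hα : 0 < α) (hV : ∀ x z, |V x - V z| ≤ C * symDist θ x z ^ α) :
    (haarIFS ψ V β).HasDiniWeights (symDist θ) := by
  intro p
  have hinteg : IntegrableOn (fun t : ℝ => |β| * |C| * t ^ (α - 1)) (Set.Ioc 0 1) :=
    ((intervalIntegrable_iff_integrableOn_Ioc_of_le zero_le_one).1
      (intervalIntegral.intervalIntegrable_rpow' (by linarith : -1 < α - 1))).const_mul _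
  refine lt_of_le_of_lt (setLIntegral_mono' measurableSet_Ioc fun t ht => ?_) hinteg.lintegral_lt_top
  refine iSup_le fun y => iSup_le fun z => iSup_le fun hyz => ENNReal.ofReal_le_ofReal ?_
  have hlog : Real.log ((haarIFS ψ V β).weight p y) - Real.log ((haarIFS ψ V β).weight p z) =
      -β * (V (ψ p.1 p.2 y) - V (ψ p.1 p.2 z)) := by
    simp only [haarIFS, ContinuousMap.coe_mk, Real.log_exp]
    ring
  rw [hlog, abs_mul, abs_neg, div_le_iff₀ ht.1, mul_assoc, ← Real.rpow_add_one ht.1.ne',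
    sub_add_cancel, mul_assoc]
  refine mul_le_mul_of_nonneg_left ?_ (abs_nonneg β)
  have hs := symDist_nonneg h0 y z
  have e1 : symDist θ (ψ p.1 p.2 y) (ψ p.1 p.2 z) ≤ t := by
    nlinarith [hL p.1 p.2 y z]
  have e2 := Real.rpow_le_rpow (symDist_nonneg h0 _ _) e1 hα.le
  calc _ ≤ C * _ := hV _ _
    _ ≤ |C| * _ := mul_le_mul_of_nonneg_right (le_abs_self C)
      (Real.rpow_nonneg (symDist_nonneg h0 _ _) _)
    _ ≤ _ := mul_le_mul_of_nonneg_left e2 (abs_nonneg C)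

/-- Raising the distance to the power `α` makes the Hölder potential Lipschitz and turns the
contraction rate into `L ^ α`. The summand `1` keeps the distortion constant strictly positive, as
the cone argument requires. -/
theorem haarIFS_restrict_hasBoundedDistortion (h0 : 0 < θ) (h1 : θ < 1) (hL0 : 0 ≤ L) (hL1 : L < 1)
    (hL : ∀ (j : Fin d) (i : Fin (k j)) (x z : SymbolicSpace d),
      symDist θ (ψ j i x) (ψ j i z) ≤ L * symDist θ x z)
    {α C : ℝ} (hα : 0 < α) (hV : ∀ x z, |V x - V z| ≤ C * symDist θ x z ^ α)
    (K : TopologicalSpace.NonemptyCompacts (SymbolicSpace d))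
    (hK : (haarIFS ψ V β).IsAttractor K) :
    ((haarIFS ψ V β).restrict K hK).HasBoundedDistortion
      (fun x z => symDist θ x.1 z.1 ^ α) (L ^ α) (|β| * |C| + 1) := by
  have hcon : ∀ (p : (j : Fin d) × Fin (k j)) (x z : SymbolicSpace d),
      symDist θ (ψ p.1 p.2 x) (ψ p.1 p.2 z) ^ α ≤ L ^ α * symDist θ x z ^ α := fun p x z => by
    rw [← Real.mul_rpow hL0 (symDist_nonneg h0 _ _)]
    exact Real.rpow_le_rpow (symDist_nonneg h0 _ _) (hL _ _ _ _) hα.le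
  refine ⟨fun x z => Real.rpow_nonneg (symDist_nonneg h0 _ _) _,
    fun x z => Real.rpow_le_one (symDist_nonneg h0 _ _) (symDist_le_one h0 h1 _ _) hα.le,
    fun x z => by rw [symDist_comm], fun p x z => hcon p x z, fun p x z => ?_⟩
  change Real.exp (-β * V (ψ p.1 p.2 x)) ≤
    Real.exp ((|β| * |C| + 1) * symDist θ x.1 z.1 ^ α) * Real.exp (-β * V (ψ p.1 p.2 z))
  rw [← Real.exp_add, Real.exp_le_exp]
  have hD : 0 ≤ symDist θ x.1 z.1 ^ α := Real.rpow_nonneg (symDist_nonneg h0 _ _) _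
  have e0 : L ^ α ≤ 1 := Real.rpow_le_one hL0 hL1.le hα.le
  have e1 : |V (ψ p.1 p.2 x) - V (ψ p.1 p.2 z)| ≤ |C| * symDist θ x.1 z.1 ^ α := by
    calc _ ≤ C * _ := hV _ _
      _ ≤ |C| * _ := mul_le_mul_of_nonneg_right (le_abs_self C)
        (Real.rpow_nonneg (symDist_nonneg h0 _ _) _)
      _ ≤ |C| * (1 * symDist θ x.1 z.1 ^ α) := mul_le_mul_of_nonneg_left
        ((hcon p x z).trans (mul_le_mul_of_nonneg_right e0 hD)) (abs_nonneg C)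
      _ = _ := by rw [one_mul]
  have e2 : -β * (V (ψ p.1 p.2 x) - V (ψ p.1 p.2 z)) ≤ |β| * (|C| * symDist θ x.1 z.1 ^ α) := by
    refine (le_abs_self _).trans ?_
    rw [abs_mul, abs_neg]
    exact mul_le_mul_of_nonneg_left e1 (abs_nonneg β)
  linarith

end Representation

/-! ### Conformality of the eigenmeasure -/

section Conformal

variable {Y ι : Type*} [TopologicalSpace Y] [MeasurableSpace Y] [BorelSpace Y] [Fintype ι]

namespace WeightedIFS

/-- An eigenmeasure on the attractor, seen on the ambient space, is fixed up to the factor `ρ` by the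
dual of the transfer operator. -/
theorem IsPerronPair.smul_map_eq_sum [CompactSpace Y] [T2Space Y] [HasOuterApproxClosed Y]
    {R : WeightedIFS Y ι}
    {K : TopologicalSpace.NonemptyCompacts Y} {hK : R.IsAttractor K} {h : C(K, ℝ)}
    {μ : ProbabilityMeasure K} (hp : (R.restrict K hK).IsPerronPair h μ)
    (hρ : 0 < (R.restrict K hK).rho) :
    ENNReal.ofReal (R.restrict K hK).rho • (μ : Measure K).map Subtype.val =
      ∑ i, (((μ : Measure K).map Subtype.val).withDensity
        fun y => ENNReal.ofReal (R.weight i y)).map (R.map i) := by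
  set M : Measure Y := (μ : Measure K).map Subtype.val with hM
  have hMp : IsProbabilityMeasure M :=
    Measure.isProbabilityMeasure_map measurable_subtype_coe.aemeasurable
  have hinteg : ∀ f : C(Y, ℝ), Integrable f M := fun f =>
    (BoundedContinuousFunction.mkOfCompact f).integrable M
  have hfin : ∀ i, IsFiniteMeasure (M.withDensity fun y => ENNReal.ofReal (R.weight i y)) :=
    fun i => isFiniteMeasure_withDensity_ofReal (hinteg (R.weight i)).2
  have hfinM : IsFiniteMeasure (ENNReal.ofReal (R.restrict K hK).rho • M) :=
    Measure.smul_finite M ENNReal.ofReal_ne_top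
  refine ext_of_forall_integral_eq_of_IsFiniteMeasure fun f => ?_
  have hmap : ∀ g : C(Y, ℝ), ∫ y, g y ∂M = ∫ y : K, g y ∂(μ : Measure K) := fun g =>
    integral_map measurable_subtype_coe.aemeasurable g.continuous.aestronglyMeasurable
  have hterm : ∀ i, ∫ y, f y ∂((M.withDensity fun y => ENNReal.ofReal (R.weight i y)).map (R.map i)) =
      ∫ y, R.weight i y * f (R.map i y) ∂M := by
    intro i
    rw [integral_map (R.map i).continuous.measurable.aemeasurable
      f.continuous.aestronglyMeasurable, integral_withDensity_eq_integral_toReal_smul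
      (R.weight i).continuous.measurable.ennreal_ofReal
      (Eventually.of_forall fun _ => ENNReal.ofReal_lt_top)]
    refine integral_congr_ae (Eventually.of_forall fun y => ?_)
    simp [ENNReal.toReal_ofReal (R.weight_pos i y).le]
  rw [integral_finsetSum_measure fun i _ => f.integrable _, integral_smul_measure,
    ENNReal.toReal_ofReal hρ.le, smul_eq_mul]
  have heig := hp.eigenmeasure (f.toContinuousMap.comp ⟨Subtype.val, continuous_subtype_val⟩)
  simp_rw [hterm]
  have hterm' : ∀ i, ∫ y, R.weight i y * f (R.map i y) ∂M =
      ∫ y : K, R.weight i y * f (R.map i y) ∂(μ : Measure K) := fun i =>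
    hmap (R.weight i * f.toContinuousMap.comp (R.map i))
  simp_rw [hterm']
  rw [← integral_finsetSum]
  · refine (Eq.trans heig ?_).symm.trans ?_
    · exact congrArg _ (hmap f.toContinuousMap).symm
    · refine integral_congr_ae (Eventually.of_forall fun y => ?_)
      simp only [transfer_apply]
      rfl
  · intro i _
    exact (BoundedContinuousFunction.mkOfCompact
      ((R.weight i * f.toContinuousMap.comp (R.map i)).comp
        (⟨Subtype.val, continuous_subtype_val⟩ : C(K, Y)))).integrable (μ : Measure K)

variable {R : WeightedIFS Y ι} {M : Measure Y} {ρ : ℝ}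

/-- The eigenmeasure equation extends from continuous to Borel test functions. This is needed
because sums over classes of Borel functions are only Borel. This nonnegative version yields
absolute convergence. -/
theorem mul_lintegral_eq_of_conformal
    (hM : ENNReal.ofReal ρ • M =
      ∑ i, (M.withDensity fun y => ENNReal.ofReal (R.weight i y)).map (R.map i))
    {f : Y → ℝ≥0∞} (hf : Measurable f) :
    ENNReal.ofReal ρ * ∫⁻ y, f y ∂M =
      ∫⁻ y, ∑ i, ENNReal.ofReal (R.weight i y) * f (R.map i y) ∂M := by
  have hw : ∀ i, Measurable fun y => ENNReal.ofReal (R.weight i y) := fun i =>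
    (R.weight i).continuous.measurable.ennreal_ofReal
  have hm : ∀ i, Measurable (R.map i) := fun i => (R.map i).continuous.measurable
  rw [← smul_eq_mul, ← lintegral_smul_measure, hM, lintegral_finsetSum_measure,
    lintegral_finsetSum Finset.univ
      (f := fun i y => ENNReal.ofReal (R.weight i y) * f (R.map i y))
      fun i _ => (hw i).mul (hf.comp (hm i))]
  refine Finset.sum_congr rfl fun i _ => ?_
  rw [lintegral_map hf (hm i)]
  exact lintegral_withDensity_eq_lintegral_mul _ (hw i) (hf.comp (hm i))

theorem mul_integral_eq_of_conformal (hρ : 0 < ρ)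
    (hM : ENNReal.ofReal ρ • M =
      ∑ i, (M.withDensity fun y => ENNReal.ofReal (R.weight i y)).map (R.map i))
    {f : Y → ℝ} (hf : Measurable f) (hfi : Integrable f M) :
    ρ * ∫ y, f y ∂M = ∫ y, ∑ i, R.weight i y * f (R.map i y) ∂M := by
  have hw : ∀ i, Measurable fun y => ENNReal.ofReal (R.weight i y) := fun i =>
    (R.weight i).continuous.measurable.ennreal_ofReal
  have hm : ∀ i, Measurable (R.map i) := fun i => (R.map i).continuous.measurable
  have htop : ∀ i, ∀ᵐ y ∂M, ENNReal.ofReal (R.weight i y) < ∞ := fun i =>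
    Eventually.of_forall fun _ => ENNReal.ofReal_lt_top
  have hinteg : ∀ i ∈ Finset.univ,
      Integrable f ((M.withDensity fun y => ENNReal.ofReal (R.weight i y)).map (R.map i)) :=
    integrable_finsetSum_measure.1 (hM ▸ hfi.smul_measure ENNReal.ofReal_ne_top)
  have hto : ∀ i y, (ENNReal.ofReal (R.weight i y)).toReal = R.weight i y := fun i y =>
    ENNReal.toReal_ofReal (R.weight_pos i y).le
  have hinteg' : ∀ i, Integrable (fun y => R.weight i y * f (R.map i y)) M := fun i => by
    have h1 := (integrable_map_measure hf.aestronglyMeasurable (hm i).aemeasurable).1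
      (hinteg i (Finset.mem_univ i))
    rw [integrable_withDensity_iff_integrable_smul' (hw i) (htop i)] at h1
    simpa only [hto, smul_eq_mul, Function.comp_apply] using h1
  have h1 : ∫ y, f y ∂(ENNReal.ofReal ρ • M) = ρ * ∫ y, f y ∂M := by
    rw [integral_smul_measure, ENNReal.toReal_ofReal hρ.le, smul_eq_mul]
  rw [← h1, hM, integral_finsetSum_measure hinteg, integral_finsetSum _ fun i _ => hinteg' i]
  refine Finset.sum_congr rfl fun i _ => ?_
  rw [integral_map (hm i).aemeasurable hf.aestronglyMeasurable,
    integral_withDensity_eq_integral_toReal_smul (hw i) (htop i)]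
  simp only [hto, smul_eq_mul]

end WeightedIFS

end Conformal

/-! ### Quasi-invariance -/

section QuasiInvariance

variable {d : ℕ} {r : Setoid (SymbolicSpace d)} {k : Fin d → ℕ}
  {ψ : (j : Fin d) → Fin (k j) → C(SymbolicSpace d, SymbolicSpace d)}

/-- The counting measure on a class is the sum of the Dirac masses at the listed points. -/
theorem IsRepresentation.transverse_concat (hψ : IsRepresentation r ψ) (j : Fin d)
    (x : SymbolicSpace d) :
    transverse r (concat j x) = ∑ i, Measure.dirac (ψ j i x) := by
  classical
  obtain ⟨hinj, hrange⟩ := hψ j x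
  have hset : {s | r s (concat j x)} =
      ((Finset.univ.image fun i => ψ j i x : Finset (SymbolicSpace d)) : Set (SymbolicSpace d)) := by
    rw [← hrange]
    simp
  ext A hA
  rw [transverse, hset, ← lintegral_indicator_one hA, lintegral_finset,
    Finset.sum_image fun a _ b _ hab => hinj hab]
  simp [Measure.dirac_apply' _ hA]

theorem IsRepresentation.rel (hψ : IsRepresentation r ψ) (j : Fin d) (i : Fin (k j))
    (x : SymbolicSpace d) : r (ψ j i x) (concat j x) := by
  have h : ψ j i x ∈ Set.range fun i => ψ j i x := ⟨i, rfl⟩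
  rw [(hψ j x).2] at h
  exact h

theorem transverse_congr {x y : SymbolicSpace d} (h : r x y) : transverse r x = transverse r y := by
  unfold transverse
  congr 1
  ext s
  exact ⟨fun hs => r.trans hs h, fun hs => r.trans hs (r.symm h)⟩

theorem IsRepresentation.transverse_apply (hψ : IsRepresentation r ψ) (j : Fin d) (i : Fin (k j))
    (x : SymbolicSpace d) :
    transverse r (ψ j i x) = ∑ i', Measure.dirac (ψ j i' x) := by
  rw [transverse_congr (hψ.rel j i x), hψ.transverse_concat]

theorem IsRepresentation.transverse_eq (hψ : IsRepresentation r ψ) (x : SymbolicSpace d) :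
    transverse r x = ∑ i, Measure.dirac (ψ (x 0) i fun n => x (n + 1)) := by
  conv_lhs => rw [← concat_tail x]
  exact hψ.transverse_concat _ _

theorem lintegral_sum_univ_dirac {X : Type*} [MeasurableSpace X] [MeasurableSingletonClass X] {n : ℕ}
    (a : Fin n → X) (f : X → ℝ≥0∞) : ∫⁻ s, f s ∂(∑ i, Measure.dirac (a i)) = ∑ i, f (a i) := by
  rw [lintegral_finsetSum_measure]
  simp

theorem integral_sum_univ_dirac {X : Type*} [MeasurableSpace X] [MeasurableSingletonClass X] {n : ℕ}
    (a : Fin n → X) (f : X → ℝ) : ∫ s, f s ∂(∑ i, Measure.dirac (a i)) = ∑ i, f (a i) := by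
  rw [integral_finsetSum_measure fun i _ => integrable_dirac (by simp)]
  simp

theorem measurable_tail : Measurable fun (x : SymbolicSpace d) (n : ℕ) => x (n + 1) :=
  measurable_pi_lambda _ fun n => measurable_pi_apply (n + 1)

/-- The groupoid is a finite union of graphs of continuous maps of the tail, each over a set fixing
the first letter. So extension by zero from `G` preserves Borel functions. -/
theorem IsRepresentation.measurableSet_rel (hψ : IsRepresentation r ψ) :
    MeasurableSet {p : SymbolicSpace d × SymbolicSpace d | r p.1 p.2} := by
  have h : {p : SymbolicSpace d × SymbolicSpace d | r p.1 p.2} =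
      ⋃ j, ⋃ i : Fin (k j), {p | p.2 0 = j} ∩ {p | p.1 = ψ j i fun n => p.2 (n + 1)} := by
    ext ⟨s, x⟩
    simp only [Set.mem_ofPred_eq, Set.mem_iUnion, Set.mem_inter_iff]
    constructor
    · intro hs
      have hs' : s ∈ {s | r s (concat (x 0) fun n => x (n + 1))} := by rwa [concat_tail]
      rw [← (hψ _ _).2] at hs'
      obtain ⟨i, hi⟩ := hs'
      exact ⟨x 0, i, rfl, hi.symm⟩
    · rintro ⟨j, i, rfl, rfl⟩
      have := hψ.rel (x 0) i fun n => x (n + 1)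
      rwa [concat_tail] at this
  rw [h]
  refine MeasurableSet.iUnion fun j => MeasurableSet.iUnion fun i => MeasurableSet.inter ?_ ?_
  · exact measurableSet_eq_fun ((measurable_pi_apply 0).comp measurable_snd) measurable_const
  · exact measurableSet_eq_fun measurable_fst
      ((ψ j i).continuous.measurable.comp (measurable_tail.comp measurable_snd))

/-- Sums over the classes depend measurably on the class. -/
theorem IsRepresentation.measurable_sum {E : Type*} [MeasurableSpace E] [AddCommMonoid E]
    [MeasurableAdd₂ E] {g : SymbolicSpace d → SymbolicSpace d → E}
    (hg : Measurable fun p : SymbolicSpace d × SymbolicSpace d => g p.1 p.2) :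
    Measurable fun x => ∑ i, g (ψ (x 0) i fun n => x (n + 1)) x := by
  -- The index type depends on `x` through its first letter; splitting over that letter makes it
  -- constant.
  have h : (fun x => ∑ i, g (ψ (x 0) i fun n => x (n + 1)) x) = fun x : SymbolicSpace d =>
      ∑ j, if x 0 = j then ∑ i, g (ψ j i fun n => x (n + 1)) x else 0 := by
    funext x
    simp
  rw [h]
  refine Finset.measurable_fun_sum _ fun j _ => Measurable.ite
    (measurableSet_eq_fun (measurable_pi_apply 0) measurable_const) ?_ measurable_const
  refine Finset.measurable_fun_sum _ fun i _ => ?_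
  exact hg.comp (((ψ j i).continuous.measurable.comp measurable_tail).prodMk measurable_id)

/-- After one application of the dual operator, both sides become integrals of finite double sums
over the same classes, which agree pointwise by exchanging the two variables. -/
theorem IsRepresentation.isQuasiInvariant_of_conformal (hψ : IsRepresentation r ψ)
    {V : C(SymbolicSpace d, ℝ)} {c : SymbolicSpace d → SymbolicSpace d → ℝ}
    (hc : IsSeparableCocycle r c V) {β ρ : ℝ} (hρ : 0 < ρ)
    (M : ProbabilityMeasure (SymbolicSpace d))
    (hM : ENNReal.ofReal ρ • (M : Measure (SymbolicSpace d)) =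
      ∑ p, ((M : Measure (SymbolicSpace d)).withDensity
        fun y => ENNReal.ofReal ((haarIFS ψ V β).weight p y)).map ((haarIFS ψ V β).map p)) :
    IsQuasiInvariant r c β M := by
  classical
  intro h hmeas hfin
  have hG := hψ.measurableSet_rel
  let h' : SymbolicSpace d × SymbolicSpace d → ℝ := fun p =>
    if r p.1 p.2 then h p.1 p.2 else 0
  have hh' : Measurable h' := by
    refine measurable_of_restrict_of_restrict_compl hG ?_ ?_
    · have e : {p : SymbolicSpace d × SymbolicSpace d | r p.1 p.2}.domRestrict h' =
          fun p => h p.1.1 p.1.2 := funext fun p => if_pos p.2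
      rw [e]
      exact hmeas
    · have e : {p : SymbolicSpace d × SymbolicSpace d | r p.1 p.2}ᶜ.domRestrict h' =
          fun _ => 0 := funext fun p => if_neg p.2
      rw [e]
      exact measurable_const
  let g : SymbolicSpace d → SymbolicSpace d → ℝ := fun s x => h' (s, x)
  let g' : SymbolicSpace d → SymbolicSpace d → ℝ := fun s x =>
    h' (x, s) * Real.exp (-β * (V s - V x))
  have hg : Measurable fun p : SymbolicSpace d × SymbolicSpace d => g p.1 p.2 := hh'
  have hg' : Measurable fun p : SymbolicSpace d × SymbolicSpace d => g' p.1 p.2 := by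
    have := V.continuous.measurable
    exact (hh'.comp measurable_swap).mul (by fun_prop)
  have hrel : ∀ (x : SymbolicSpace d) (i : Fin (k (x 0))),
      r (ψ (x 0) i fun n => x (n + 1)) x := fun x i => by
    have := hψ.rel (x 0) i fun n => x (n + 1)
    rwa [concat_tail] at this
  have hgh : ∀ s x, r s x → h s x = g s x := fun s x hs => (if_pos hs).symm
  have hgh' : ∀ s x, r s x → h x s * Real.exp (-β * c x s) = g' s x := fun s x hs => by
    simp only [g', h', if_pos (r.symm hs), hc x s (r.symm hs)]
  let F : SymbolicSpace d → ℝ := fun x => ∑ i, g (ψ (x 0) i fun n => x (n + 1)) x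
  let F' : SymbolicSpace d → ℝ := fun x => ∑ i, g' (ψ (x 0) i fun n => x (n + 1)) x
  let E : SymbolicSpace d → ℝ≥0∞ := fun x => ∑ i, ‖g (ψ (x 0) i fun n => x (n + 1)) x‖ₑ
  let E' : SymbolicSpace d → ℝ≥0∞ := fun x => ∑ i, ‖g' (ψ (x 0) i fun n => x (n + 1)) x‖ₑ
  have hF : Measurable F := IsRepresentation.measurable_sum hg
  have hF' : Measurable F' := IsRepresentation.measurable_sum hg'
  have hE : Measurable E := IsRepresentation.measurable_sum (g := fun s x => ‖g s x‖ₑ) hg.enorm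
  have hE' : Measurable E' := IsRepresentation.measurable_sum (g := fun s x => ‖g' s x‖ₑ) hg'.enorm
  have iE : ∀ x, ∫⁻ s, ‖h s x‖ₑ ∂(transverse r x) = E x := fun x => by
    rw [hψ.transverse_eq, lintegral_sum_univ_dirac]
    exact Finset.sum_congr rfl fun i _ => by rw [hgh _ _ (hrel x i)]
  have iE' : ∀ x, ∫⁻ s, ‖h x s * Real.exp (-β * c x s)‖ₑ ∂(transverse r x) = E' x := fun x => by
    rw [hψ.transverse_eq, lintegral_sum_univ_dirac]
    exact Finset.sum_congr rfl fun i _ => by rw [hgh' _ _ (hrel x i)]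
  have iF : ∀ x, ∫ s, h s x ∂(transverse r x) = F x := fun x => by
    rw [hψ.transverse_eq, integral_sum_univ_dirac]
    exact Finset.sum_congr rfl fun i _ => by rw [hgh _ _ (hrel x i)]
  have iF' : ∀ x, ∫ s, h x s * Real.exp (-β * c x s) ∂(transverse r x) = F' x := fun x => by
    rw [hψ.transverse_eq, integral_sum_univ_dirac]
    exact Finset.sum_congr rfl fun i _ => by rw [hgh' _ _ (hrel x i)]
  -- The class of `ψ j i x` is listed a priori through its own first letter; the list of `[j * x]`
  -- enumerates the same class, so the double sum becomes a square sum over `i` and `i'`.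
  have hsum : ∀ (f : SymbolicSpace d → SymbolicSpace d → ℝ) (j : Fin d) (i : Fin (k j))
      (x : SymbolicSpace d), ∑ i', f (ψ ((ψ j i x) 0) i' fun n => (ψ j i x) (n + 1)) (ψ j i x) =
        ∑ i', f (ψ j i' x) (ψ j i x) := fun f j i x => by
    rw [← integral_sum_univ_dirac _ fun s => f s (ψ j i x), ← hψ.transverse_eq, hψ.transverse_apply,
      integral_sum_univ_dirac]
  have hsumE : ∀ (f : SymbolicSpace d → SymbolicSpace d → ℝ≥0∞) (j : Fin d) (i : Fin (k j))
      (x : SymbolicSpace d), ∑ i', f (ψ ((ψ j i x) 0) i' fun n => (ψ j i x) (n + 1)) (ψ j i x) =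
        ∑ i', f (ψ j i' x) (ψ j i x) := fun f j i x => by
    rw [← lintegral_sum_univ_dirac _ fun s => f s (ψ j i x), ← hψ.transverse_eq, hψ.transverse_apply,
      lintegral_sum_univ_dirac]
  have hswap : ∀ s y, Real.exp (-β * V y) * g' s y = Real.exp (-β * V s) * g y s := fun s y => by
    simp only [g', g]
    rw [mul_left_comm, ← Real.exp_add, mul_comm]
    ring_nf
  have kF : ∀ x, ∑ p, (haarIFS ψ V β).weight p x * F ((haarIFS ψ V β).map p x) =
      ∑ p, (haarIFS ψ V β).weight p x * F' ((haarIFS ψ V β).map p x) := fun x => by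
    rw [Fintype.sum_sigma, Fintype.sum_sigma]
    refine Finset.sum_congr rfl fun j _ => ?_
    simp only [haarIFS, ContinuousMap.coe_mk, F, F', hsum, Finset.mul_sum, hswap]
    exact Finset.sum_comm
  have kE : ∀ x, ∑ p, ENNReal.ofReal ((haarIFS ψ V β).weight p x) * E ((haarIFS ψ V β).map p x) =
      ∑ p, ENNReal.ofReal ((haarIFS ψ V β).weight p x) * E' ((haarIFS ψ V β).map p x) := fun x => by
    have hen : ∀ (y : SymbolicSpace d) (t : ℝ), ENNReal.ofReal (Real.exp (-β * V y)) * ‖t‖ₑ =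
        ‖Real.exp (-β * V y) * t‖ₑ := fun y t => by
      rw [enorm_mul, Real.enorm_of_nonneg (Real.exp_pos _).le]
    rw [Fintype.sum_sigma, Fintype.sum_sigma]
    refine Finset.sum_congr rfl fun j _ => ?_
    simp only [haarIFS, ContinuousMap.coe_mk, E, E', hsumE (fun s y => ‖g s y‖ₑ),
      hsumE (fun s y => ‖g' s y‖ₑ), Finset.mul_sum, hen, hswap]
    exact Finset.sum_comm
  simp only [iE, iE', iF, iF'] at hfin ⊢
  -- The identity for absolute values comes first: it supplies the integrability of the right-hand
  -- side used for the signed one.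
  have hEE : ∫⁻ x, E x ∂(M : Measure (SymbolicSpace d)) =
      ∫⁻ x, E' x ∂(M : Measure (SymbolicSpace d)) := by
    have h1 := WeightedIFS.mul_lintegral_eq_of_conformal hM hE
    have h2 := WeightedIFS.mul_lintegral_eq_of_conformal hM hE'
    simp only [kE] at h1
    exact (ENNReal.mul_right_inj (by simpa using hρ) ENNReal.ofReal_ne_top).1 (h1.trans h2.symm)
  have hfin' : ∫⁻ x, E' x ∂(M : Measure (SymbolicSpace d)) < ∞ := hEE ▸ hfin
  refine ⟨hfin', ?_⟩
  have hFi : Integrable F (M : Measure (SymbolicSpace d)) :=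
    ⟨hF.aestronglyMeasurable, (lintegral_mono fun x => enorm_sum_le _ _).trans_lt hfin⟩
  have hFi' : Integrable F' (M : Measure (SymbolicSpace d)) :=
    ⟨hF'.aestronglyMeasurable, (lintegral_mono fun x => enorm_sum_le _ _).trans_lt hfin'⟩
  have h1 := WeightedIFS.mul_integral_eq_of_conformal hρ hM hF hFi
  have h2 := WeightedIFS.mul_integral_eq_of_conformal hρ hM hF' hFi'
  simp only [kF] at h1
  exact mul_left_cancel₀ hρ.ne' (h1.trans h2.symm)

end QuasiInvariance

theorem mainTheorem3 (d : ℕ) (hd : 0 < d) (θ : ℝ) (hθ0 : 0 < θ) (hθ1 : θ < 1)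
    (r : Setoid (SymbolicSpace d)) (k : Fin d → ℕ)
    (ψ : (j : Fin d) → Fin (k j) → C(SymbolicSpace d, SymbolicSpace d))
    (hψ : IsRepresentation r ψ)
    (hLip : ∃ L : ℝ, 0 ≤ L ∧ L < 1 ∧ ∀ (j : Fin d) (i : Fin (k j)) (x z : SymbolicSpace d),
      symDist θ (ψ j i x) (ψ j i z) ≤ L * symDist θ x z)
    (V : C(SymbolicSpace d, ℝ)) (α : ℝ) (hα : 0 < α)
    (hV : ∃ C : ℝ, ∀ x z : SymbolicSpace d, |V x - V z| ≤ C * symDist θ x z ^ α)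
    (c : SymbolicSpace d → SymbolicSpace d → ℝ) (hc : IsSeparableCocycle r c V) (β : ℝ) :
    (haarIFS ψ V β).IsContractive (symDist θ) ∧
    (haarIFS ψ V β).HasDiniWeights (symDist θ) ∧
    (∃! K : TopologicalSpace.NonemptyCompacts (SymbolicSpace d), (haarIFS ψ V β).IsAttractor K) ∧
    ∀ (K : TopologicalSpace.NonemptyCompacts (SymbolicSpace d)) (hK : (haarIFS ψ V β).IsAttractor K),
      0 < ((haarIFS ψ V β).restrict K hK).rho ∧
      (∃! p : C(K, ℝ) × ProbabilityMeasure K,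
        ((haarIFS ψ V β).restrict K hK).IsPerronPair p.1 p.2) ∧
      ∀ (h : C(K, ℝ)) (μ : ProbabilityMeasure K),
        ((haarIFS ψ V β).restrict K hK).IsPerronPair h μ →
        IsQuasiInvariant r c β (μ.map measurable_subtype_coe.aemeasurable) := by
  obtain ⟨L, hL0, hL1, hL⟩ := hLip
  obtain ⟨C, hC⟩ := hV
  refine ⟨⟨L, hL0, hL1, fun p x z => hL p.1 p.2 x z⟩,
    haarIFS_hasDiniWeights hθ0 hL1 hL hα hC,
    hψ.existsUnique_isAttractor hd hθ0 hθ1 hL1 hL, fun K hK => ?_⟩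
  -- Classes are non-empty by reflexivity, so the system has at least one map and the operator
  -- preserves strict positivity.
  have : Nonempty ((j : Fin d) × Fin (k j)) := by
    obtain ⟨i, -⟩ := hψ.exists_eq fun _ => ⟨0, hd⟩
    exact ⟨⟨_, i⟩⟩
  have : HasOuterApproxClosed K := by
    have : TopologicalSpace.MetrizableSpace K :=
      inferInstanceAs (TopologicalSpace.MetrizableSpace (K : Set (SymbolicSpace d)))
    let := TopologicalSpace.metrizableSpaceMetric K
    infer_instance
  obtain ⟨hρ, hpair⟩ :=
    (haarIFS_restrict_hasBoundedDistortion (β := β) hθ0 hθ1 hL0 hL1 hL hα hC K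
      hK).rho_pos_and_existsUnique (Real.rpow_nonneg hL0 α) (Real.rpow_lt_one hL0 hL1 hα)
      (by positivity) (dense_symDist_lipschitz hθ0 hθ1 hα K)
  exact ⟨hρ, hpair, fun h μ hp =>
    hψ.isQuasiInvariant_of_conformal hc hρ _ (hp.smul_map_eq_sum hρ)⟩
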